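/- **Setting.** Let $\Phi(X,\theta)\in\mathbb R^n$ be a fully connected feedforward network with $k$ hidden layers, $\Phi_0=v_0^\top X_a$, $\Phi_j=v_j^\top\phi_j(\Phi_{j-1})$ ($1\le j\le k$), $\Phi=\Phi_k$, where $X\in\mathbb R^{2n}$, $X_a=(X,1)$, $\theta=(\mathrm{vec}\,v_0,\dots,\mathrm{vec}\,v_k)\in\mathbb R^\rho$, each $\phi_j$ acts componentwise by smooth functions and has last component $1$; let $\Phi'=\partial\Phi/\partial\theta$ (note $\Phi(X,0)=0$). The plant is $\ddot x=f(X)+u$, $X=(x,\dot x)$, $f\in C^1$, and $x_d\in C^2$ is a reference with $\|x_d\|\le\overline{x_d}$, $\|\dot x_d\|\le\overline{\dot x_d}$, $\|\ddot x_d\|\le\overline{\ddot x_d}$ on $[t_0,\infty)$. Let $\Theta=\{P\le 0\}\ni 0$ be compact, $P$ convex and $C^1$ with $\min P<0$, $\epsilon>0$, $\Theta_\epsilon=\{P\le\epsilon\}$, $\bar\theta=\max_{\Theta}\|\theta\|$, $\theta^*\in\Theta$, and $\varepsilon(X)=f(X)-\Phi(X,\theta^*)$. Put $e=x-x_d$,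 $r=\dot e+\alpha_1e$, $\tilde\theta=\theta^*-\hat\theta$, $\zeta=(r,e,\tilde\theta)$ and $$u=\ddot x_d-\Phi(X,\hat\theta)-k_1r-e-\alpha_1\dot e,$$ $$\dot{\hat r}=\hat\Delta-\ddot x_d+\alpha_1\dot e+\alpha_2\tilde r,\qquad \dot{\hat\Delta}=\tilde r+k_\Delta\tilde\Delta+\dot u,\qquad \tilde r=r-\hat r,\ \tilde\Delta=\ddot x-\hat\Delta,\ z=(\tilde r,\tilde\Delta).$$ The gains $k_1,\alpha_1,\alpha_2,k_\Delta,\gamma_1,\gamma_2$ and the accuracy $\delta_\Delta$ are positive. Data $X_i=X(t_i)$, $u_i=u(t_i)$, $\hat\Delta_i=\hat\Delta(t_i)$ are recorded at times $t_1,\dots,t_N\ge t_\Delta$, where $\Lambda_1=\min\{k_\Delta,2\alpha_2\}$, $t_\Delta=t_0$ if $\|z(t_0)\|\le\delta_\Delta$, and otherwise $t_\Delta=t_0+\frac1{\Lambda_1}\ln\frac{k_\Delta\Lambda_1\|z(t_0)\|^2-\delta_f^2}{k_\Delta\Lambda_1\delta_\Delta^2-\delta_f^2}$. With sums over the data already recorded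 ($t_i\le t$), the second concurrent-learning law is $$\dot{\hat\theta}=\mathrm{proj}\Bigl(\Gamma\bigl(\Phi'^\top(X,\hat\theta)r-\gamma_2\hat\theta-\gamma_1\textstyle\sum_{i}\Phi'^\top(X_i,\hat\theta)(u_i-\hat\Delta_i+\Phi'(X_i,\hat\theta)\hat\theta)\bigr)\Bigr),\qquad \hat\theta(t_0)\in\Theta_\epsilon,$$ where $\mathrm{proj}(\tau)=\tau$ if $P(\hat\theta)\le0$ or $\nabla P(\hat\theta)^\top\tau\le 0$, and $\mathrm{proj}(\tau)=\tau-\min\{1,P(\hat\theta)/\epsilon\}\frac{\nabla P^\top\tau}{\nabla P^\top\Gamma\nabla P}\Gamma\nabla P$ otherwise. The symmetric gain $\Gamma$ starts with eigenvalues in $[\lambda_{\Gamma,\min},\lambda_{\Gamma,\max}]\subset(0,\infty)$, and $\frac{d}{dt}\Gamma^{-1}=-\beta\Gamma^{-1}+\gamma_1\sum_i\Phi'^\top(X_i,\hat\theta)\Phi'(X_i,\hat\theta)$ (with $\beta(t)\ge0$) while $\lambda_{\Gamma,\min}<\lambda_{\min}(\Gamma)$ and $\lambda_{\max}(\Gamma)<\lambda_{\Gamma,\max}$,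 and $\frac{d}{dt}\Gamma^{-1}=0$ otherwise. Solutions are understood in the sense of Carathéodory. **Constants.** For $\hat\theta=\theta^*-\tilde\theta\in\Theta_\epsilon$ let $R(X,\tilde\theta)=\Phi(X,\theta^*)-\Phi(X,\hat\theta)-\Phi'(X,\hat\theta)\tilde\theta$ and $R_0(X,\hat\theta)=\Phi(X,0)-\Phi(X,\hat\theta)+\Phi'(X,\hat\theta)\hat\theta$. Let $\rho_1,\rho_2,\rho_3,\rho_5:\mathbb R_{\ge0}\to\mathbb R_{\ge0}$ be strictly increasing functions such that, for all $\hat\theta\in\Theta_\epsilon$, $\|\Phi'(X,\hat\theta)\|\le\rho_1(\|X\|)$ and $\|\Phi'^\top(X,\hat\theta)(\varepsilon(X)-R_0(X,\hat\theta))\|\le\rho_5(\|X\|)$ for every $X$, and $\|R(X,\tilde\theta)\|\le\rho_2(\|\zeta\|)\|\zeta\|^2$, $\|\Phi'^\top(X_i,\hat\theta)R(X_i,\tilde\theta)\|\le\rho_3(\|\zeta_i\|)\|\zeta\|^2$ whenever $X$ and $X_i$ are the inputs $(e+x_d,\,r-\alpha_1e+\dot x_d)$ that belong to $\zeta$, respectively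 to $\zeta_i$, at some time $t\ge t_0$. For $\lambda_e\ge0$ and $\lambda_{3d}>0$ let $\lambda_3=\min\{k_1-1,\ \alpha_1,\ \frac{\gamma_1}2\lambda_e+\frac{\gamma_2}2-\frac{\gamma_1N\delta_\Delta}2-\gamma_1N\}$, let $\rho_\delta:\mathbb R_{\ge0}\to\mathbb R_{\ge0}$ be strictly increasing with $\rho_\delta(a)\ge\frac12\rho_2(a)^2a^2+\frac{\gamma_1}2\sum_{i=1}^N\rho_3(\|\zeta(t_i)\|)^2a^2$ for all $a\ge 0$, and let $\chi_4=\rho_\delta^{-1}(\lambda_3-\lambda_{3d})$, $\mathcal D_4=\{\|\zeta\|\le\chi_4\}$, $\Omega_4=\{\|X\|\le(\alpha_1+2)\chi_4+\overline{x_d}+\overline{\dot x_d}\}$, where $\theta^*$ minimizes $\int_{\Omega_4}(\|f(X)-\Phi(X,\theta)\|^2+\sigma\|\theta\|^2)\,dX$ over $\Theta$ for some $\sigma>0$, and $\|\varepsilon\|\le\bar\varepsilon$ on $\Omega_4$. Let $\delta_f>0$ bound $\|\frac{d}{dt}f(x,\dot x)\|$, computed along the closed loop, for all $t\ge t_0$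 and all $\zeta\in\mathcal D_4$. Finally let $\beta_1=\min\{\frac12,\frac1{2\lambda_{\Gamma,\max}}\}$, $\beta_2=\max\{\frac12,\frac1{2\lambda_{\Gamma,\min}}\}$, $$\iota_4=\tfrac12\bar\varepsilon^2+\tfrac{\gamma_1N\delta_\Delta}2\sum_{i=1}^N\rho_1(\|X_i\|)^2+\tfrac{\gamma_1}2\sum_{i=1}^N\rho_5(\|X_i\|)^2+\tfrac{\gamma_2}2\bar\theta^2,\qquad \mathcal H=\Bigl\{\zeta:\|\zeta\|<\sqrt{\tfrac{\beta_1}{\beta_2}\chi_4^2-\tfrac{\iota_4}{\lambda_{3d}}}\Bigr\}$$ ($\mathcal H$ is empty if the radicand is not positive). **Theorem.** Functions $\rho_1,\rho_2,\rho_3,\rho_5$ as above exist, and so does, for every radius $\chi$ in place of $\chi_4$, a bound $\delta_f$. For any choice of them, suppose $k_\Delta\Lambda_1>\delta_f^2/\delta_\Delta^2$ and $\lambda_{3d}>0$, and consider any solution of the closed loop on $[t_0,b)$, $t_0<b\le\infty$, with all recording times in $[t_0,b)$. Let $T\in[t_0,b)$ and $\lambda_e\ge0$ be such that $\lambda_{\min}\{\sum_{i:\,t_i\le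 t}\Phi'^\top(X_i,\hat\theta(t))\Phi'(X_i,\hat\theta(t))\}\ge\lambda_e$ for all $t\in[T,b)$ (for $T=t_0$, $\lambda_e=0$ this is no restriction). If $\zeta(t)\in\mathcal D_4$ for $t_0\le t<T$ (void if $T=t_0$) and $\zeta(T)\in\mathcal H$, then for all $t\in[T,b)$ $$\|\zeta(t)\|\le\sqrt{\tfrac{\beta_2}{\beta_1}\|\zeta(T)\|^2e^{-\frac{\lambda_{3d}}{\beta_2}(t-T)}+\tfrac{\beta_2\iota_4}{\beta_1\lambda_{3d}}\Bigl(1-e^{-\frac{\lambda_{3d}}{\beta_2}(t-T)}\Bigr)}.$$ Moreover $\zeta(t)\in\mathcal D_4$, $X(t)\in\Omega_4$ and $\hat\theta(t)\in\Theta_\epsilon$ for all $t\in[t_0,b)$, and the signals $e,r,\tilde\theta,x,\dot x,\hat\theta,u,z,\hat r,\hat\Delta,\Gamma,\Gamma^{-1}$ are bounded on $[t_0,b)$. -/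

import Mathlib

open MeasureTheory
open scoped ContDiff

noncomputable section

namespace CLDNN

/-! ### The feedforward network -/

/-- Architecture of a fully connected network with `k` hidden layers: layer `j` has `L j` nodes
(bias node included), the output lives in `ℝⁿ` with `n = L (k + 1)`, and the input is a vector of
`ℝ²ⁿ` augmented by a `1`, so that `L 0 = 2 n + 1`. -/
structure Arch where
  k : ℕ
  L : ℕ → ℕ
  L_pos : ∀ j, j ≤ k + 1 → 0 < L j
  L_zero : L 0 = (L (k + 1) + L (k + 1)) + 1

namespace Arch

variable (A : Arch)

/-- Dimension of the generalized position. -/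
abbrev n : ℕ := A.L (A.k + 1)

/-- `ℝⁿ` with the Euclidean norm. -/
abbrev Vec : Type := EuclideanSpace ℝ (Fin A.n)

/-- `ℝ²ⁿ` with the Euclidean norm: the space of network inputs `X = (x, ẋ)`. -/
abbrev Inp : Type := EuclideanSpace ℝ (Fin (A.n + A.n))

/-- The indices of all the weights of `v₀, …, v_k`; there are `∑ L j * L (j + 1)` of them. -/
abbrev Idx : Type := (j : Fin (A.k + 1)) × (Fin (A.L j) × Fin (A.L (j + 1)))

/-- The space `ℝ^ρ` of weight vectors `θ = (vec v₀, …, vec v_k)`. -/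
abbrev Par : Type := EuclideanSpace ℝ A.Idx

/-- The space of error vectors `ζ = (r, e, θ̃)` with the Euclidean norm. -/
abbrev Err : Type := WithLp 2 (A.Vec × WithLp 2 (A.Vec × A.Par))

variable {A}

/-- Concatenation `(x, ẋ)`. -/
def pair (x v : A.Vec) : A.Inp := WithLp.toLp 2 (Fin.append x.ofLp v.ofLp)

/-- The error vector `(r, e, θ̃)`. -/
def err (r e : A.Vec) (w : A.Par) : A.Err := WithLp.toLp 2 (r, WithLp.toLp 2 (e, w))

/-- The weight matrix `v_j`, of size `L j × L (j + 1)` (only `j ≤ k` is ever used). -/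
def weight (θ : A.Par) (j : ℕ) : Matrix (Fin (A.L j)) (Fin (A.L (j + 1))) ℝ :=
  fun a b => if h : j < A.k + 1 then θ ⟨⟨j, h⟩, (a, b)⟩ else 0

/-- The augmented input `X_a = (X, 1)`. -/
def augment (X : A.Inp) : Fin (A.L 0) → ℝ :=
  fun i => if h : (i : ℕ) < A.n + A.n then X ⟨i, h⟩ else 1

/-- The activation vector `φ_j(y) = (ς_{j,1}(y₁), …, ς_{j,L_j - 1}(y_{L_j - 1}), 1)`. -/
def act (ς : ℕ → ℕ → ℝ → ℝ) (j : ℕ) (y : Fin (A.L j) → ℝ) : Fin (A.L j) → ℝ :=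
  fun i => if (i : ℕ) + 1 = A.L j then 1 else ς j i (y i)

/-- `Φ₀ = v₀ᵀ X_a` and `Φ_j = v_jᵀ φ_j(Φ_{j-1})`. -/
def layer (ς : ℕ → ℕ → ℝ → ℝ) (X : A.Inp) (θ : A.Par) : (j : ℕ) → Fin (A.L (j + 1)) → ℝ
  | 0 => Matrix.mulVec (Matrix.transpose (weight θ 0)) (augment X)
  | j + 1 => Matrix.mulVec (Matrix.transpose (weight θ (j + 1))) (act ς (j + 1) (layer ς X θ j))

end Arch

/-! ### Spectral bounds -/

/-- Smallest eigenvalue (of a self-adjoint operator). -/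
def lamMin {W : Type*} [NormedAddCommGroup W] [NormedSpace ℝ W] (B : W →L[ℝ] W) : ℝ :=
  sInf (spectrum ℝ B)

/-- Largest eigenvalue (of a self-adjoint operator). -/
def lamMax {W : Type*} [NormedAddCommGroup W] [NormedSpace ℝ W] (B : W →L[ℝ] W) : ℝ :=
  sSup (spectrum ℝ B)

/-! ### Smooth projection -/

open Classical in
/-- The smooth projection operator with adaptation gain `G` for the convex set `{P ≤ 0}` and the
boundary layer `{0 ≤ P ≤ ε}`: with `c(θ) = min {1, P(θ)/ε}`, it returns `τ` if `P(θ) ≤ 0` or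
`∇P(θ)ᵀ τ ≤ 0`, and `(I - c(θ) G ∇P ∇Pᵀ / (∇Pᵀ G ∇P)) τ` otherwise. -/
def proj {W : Type*} [NormedAddCommGroup W] [InnerProductSpace ℝ W] [CompleteSpace W]
    (P : W → ℝ) (ε : ℝ) (G : W →L[ℝ] W) (θ τ : W) : W :=
  if P θ ≤ 0 ∨ inner ℝ (gradient P θ) τ ≤ 0 then τ
  else τ - (min 1 (P θ / ε) *
    (inner ℝ (gradient P θ) τ / inner ℝ (gradient P θ) (G (gradient P θ)))) • G (gradient P θ)

/-! ### Plant, reference trajectory, parameter set and gains -/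

/-- The data of the tracking problem: network activations, plant `ẍ = f(x, ẋ) + u`, reference
trajectory, parameter search space `Θ = {P ≤ 0}`, ideal weights, and the gains of the controller,
of the observer and of the adaptation law. -/
structure Problem (A : Arch) where
  /-- activation functions `ς_{j,i}` -/
  ς : ℕ → ℕ → ℝ → ℝ
  ς_smooth : ∀ j i, 1 ≤ j → j ≤ A.k → ContDiff ℝ ∞ (ς j i)
  /-- the unknown drift -/
  f : A.Inp → A.Vec
  f_C1 : ContDiff ℝ 1 f
  /-- initial time -/
  t₀ : ℝ
  /-- reference trajectory and the bounds on it and its first two derivatives -/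
  xd : ℝ → A.Vec
  xd_C2 : ContDiff ℝ 2 xd
  xdB : ℝ
  xdB' : ℝ
  xdB'' : ℝ
  xd_le : ∀ t, t₀ ≤ t → ‖xd t‖ ≤ xdB
  xd'_le : ∀ t, t₀ ≤ t → ‖deriv xd t‖ ≤ xdB'
  xd''_le : ∀ t, t₀ ≤ t → ‖deriv (deriv xd) t‖ ≤ xdB''
  /-- defining function of the search space `{P ≤ 0}` and width of the boundary layer -/
  P : A.Par → ℝ
  P_convex : ConvexOn ℝ Set.univ P
  P_C1 : ContDiff ℝ 1 P
  P_compact : IsCompact {θ | P θ ≤ 0}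
  P_zero : P 0 ≤ 0
  P_slater : ∃ θ, P θ < 0
  εP : ℝ
  εP_pos : 0 < εP
  /-- ideal weights -/
  θs : A.Par
  θs_mem : P θs ≤ 0
  /-- controller gains -/
  k₁ : ℝ
  α₁ : ℝ
  k₁_pos : 0 < k₁
  α₁_pos : 0 < α₁
  /-- observer gains and prescribed observer accuracy -/
  α₂ : ℝ
  kΔ : ℝ
  δΔ : ℝ
  α₂_pos : 0 < α₂
  kΔ_pos : 0 < kΔ
  δΔ_pos : 0 < δΔ
  /-- adaptation gains, forgetting factor and eigenvalue thresholds of the gain matrix -/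
  γ₁ : ℝ
  γ₂ : ℝ
  γ₁_pos : 0 < γ₁
  γ₂_pos : 0 < γ₂
  β : ℝ → ℝ
  β_nonneg : ∀ t, 0 ≤ β t
  lΓmin : ℝ
  lΓmax : ℝ
  lΓmin_pos : 0 < lΓmin
  lΓ_le : lΓmin ≤ lΓmax

namespace Problem

variable {A : Arch} (p : Problem A)

/-- The network `Φ(X, θ) = Φ_k`. -/
def Φ (X : A.Inp) (θ : A.Par) : A.Vec := WithLp.toLp 2 (Arch.layer p.ς X θ A.k)

/-- The Jacobian `Φ'(X, θ) = ∂Φ/∂θ`. -/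
def J (X : A.Inp) (θ : A.Par) : A.Par →L[ℝ] A.Vec := fderiv ℝ (fun w => p.Φ X w) θ

/-- The transpose `Φ'ᵀ(X, θ)`. -/
def JT (X : A.Inp) (θ : A.Par) : A.Vec →L[ℝ] A.Par := ContinuousLinearMap.adjoint (p.J X θ)

/-- Remainder of the first-order Taylor expansion of `Φ(X, ·)` about `θ`, evaluated at `w`. -/
def rem (X : A.Inp) (θ w : A.Par) : A.Vec := p.Φ X w - p.Φ X θ - p.J X θ (w - θ)

/-- The function approximation error `ε(X) = f(X) - Φ(X, θ*)`. -/
def appErr (X : A.Inp) : A.Vec := p.f X - p.Φ X p.θs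

/-- The search space `Θ`. -/
def Θ : Set A.Par := {θ | p.P θ ≤ 0}

/-- The set `{P ≤ ε}`, i.e. `Θ` together with the boundary layer of the projection. -/
def Θε : Set A.Par := {θ | p.P θ ≤ p.εP}

/-- `θ̄ = max {‖θ‖ : θ ∈ Θ}`. -/
def θB : ℝ := sSup ((fun θ : A.Par => ‖θ‖) '' p.Θ)

/-- The regularized loss over the compact set `Ω`. -/
def loss (σ : ℝ) (Ω : Set A.Inp) (θ : A.Par) : ℝ :=
  ∫ X in Ω, (‖p.f X - p.Φ X θ‖ ^ 2 + σ * ‖θ‖ ^ 2)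

/-- `{ζ : ‖ζ‖ ≤ χ}`. -/
def D (_p : Problem A) (χ : ℝ) : Set A.Err := {z | ‖z‖ ≤ χ}

/-- The compact set of network inputs that contains `X` whenever `ζ ∈ D χ`. -/
def Ω (χ : ℝ) : Set A.Inp := {X | ‖X‖ ≤ (p.α₁ + 2) * χ + p.xdB + p.xdB'}

/-- The input `X = (x, ẋ)` as a function of time and of the errors:
`x = e + x_d`, `ẋ = r - α₁ e + ẋ_d`. -/
def inputOf (t : ℝ) (r e : A.Vec) : A.Inp :=
  Arch.pair (e + p.xd t) (r - p.α₁ • e + deriv p.xd t)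

/-- The control law as a function of time, of the errors and of the weight estimate:
`u = ẍ_d - Φ(X, θ̂) - k₁ r - e - α₁ ė` with `ė = r - α₁ e`. -/
def ctrl (t : ℝ) (r e : A.Vec) (θh : A.Par) : A.Vec :=
  deriv (deriv p.xd) t - p.Φ (p.inputOf t r e) θh - p.k₁ • r - e - p.α₁ • (r - p.α₁ • e)

/-- `δf` bounds `d/dt f(x, ẋ) = (∂f/∂x) ẋ + (∂f/∂ẋ) ẍ`, with `ẍ` given by the closed loop, for all
errors in `D χ`. -/
def IsFdotBound (χ δf : ℝ) : Prop :=
  ∀ t, p.t₀ ≤ t → ∀ (r e : A.Vec) (w : A.Par), Arch.err r e w ∈ p.D χ →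
    ‖fderiv ℝ p.f (p.inputOf t r e)
      (Arch.pair (r - p.α₁ • e + deriv p.xd t)
        (p.f (p.inputOf t r e) + p.ctrl t r e (p.θs - w)))‖ ≤ δf

/-- A strictly increasing function `ℝ≥0 → ℝ≥0`. -/
def IncrNonneg (ρ : ℝ → ℝ) : Prop :=
  StrictMonoOn ρ (Set.Ici 0) ∧ ∀ s, 0 ≤ s → 0 ≤ ρ s

/-- `ρ₁, ρ₂, ρ₃, ρ₅` are bounding functions for the Jacobian, for the Lagrange remainder
`R(X, θ̃) = Φ(X, θ*) - Φ(X, θ̂) - Φ'(X, θ̂) θ̃` along the current errors, for the same remainder at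
a recorded input premultiplied by the transposed Jacobian, and for the approximation error minus
the remainder of the expansion towards zero weights. Here `θ̂ = θ* - θ̃` ranges over the set in
which the projection keeps it. -/
structure IsBounding (ρ₁ ρ₂ ρ₃ ρ₅ : ℝ → ℝ) : Prop where
  incr₁ : IncrNonneg ρ₁
  incr₂ : IncrNonneg ρ₂
  incr₃ : IncrNonneg ρ₃
  incr₅ : IncrNonneg ρ₅
  jac : ∀ X, ∀ θ ∈ p.Θε, ‖p.J X θ‖ ≤ ρ₁ ‖X‖
  cur : ∀ t, p.t₀ ≤ t → ∀ (r e : A.Vec) (w : A.Par), p.θs - w ∈ p.Θε →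
    ‖p.rem (p.inputOf t r e) (p.θs - w) p.θs‖ ≤ ρ₂ ‖Arch.err r e w‖ * ‖Arch.err r e w‖ ^ 2
  hist : ∀ t, p.t₀ ≤ t → ∀ (ri ei : A.Vec) (wi : A.Par) (r e : A.Vec) (w : A.Par),
    p.θs - w ∈ p.Θε →
    ‖p.JT (p.inputOf t ri ei) (p.θs - w) (p.rem (p.inputOf t ri ei) (p.θs - w) p.θs)‖
      ≤ ρ₃ ‖Arch.err ri ei wi‖ * ‖Arch.err r e w‖ ^ 2
  zero : ∀ X, ∀ θ ∈ p.Θε, ‖p.JT X θ (p.appErr X - p.rem X θ 0)‖ ≤ ρ₅ ‖X‖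

/-- `Λ₁ = min {k_Δ, 2 α₂}`. -/
def Λ₁ : ℝ := min p.kΔ (2 * p.α₂)

/-- `β₁ = min {1/2, 1/(2 λ_{Γ,max})}`. -/
def β₁ : ℝ := min (1 / 2) (1 / 2 * (1 / p.lΓmax))

/-- `β₂ = max {1/2, 1/(2 λ_{Γ,min})}`. -/
def β₂ : ℝ := max (1 / 2) (1 / 2 * (1 / p.lΓmin))

/-- The constant `λ₃` for a history stack of size `N` with excitation level `lam_e`. -/
def lam₃ (N : ℕ) (lam_e : ℝ) : ℝ :=
  min (p.k₁ - 1) (min p.α₁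
    (p.γ₁ / 2 * lam_e + p.γ₂ / 2 - p.γ₁ * N * p.δΔ / 2 - p.γ₁ * N))

end Problem

/-! ### The closed loop -/

/-- The signals of the closed loop: position, velocity, weight estimate, least-squares gain `Γ` and
its inverse, observer states, and the recording times of the history stack. -/
structure Signals (A : Arch) (N : ℕ) where
  x : ℝ → A.Vec
  v : ℝ → A.Vec
  θh : ℝ → A.Par
  Γ : ℝ → A.Par →L[ℝ] A.Par
  Γinv : ℝ → A.Par →L[ℝ] A.Par
  rh : ℝ → A.Vec
  Δh : ℝ → A.Vec
  ts : Fin N → ℝ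

namespace Signals

variable {A : Arch} {N : ℕ} (s : Signals A N) (p : Problem A)

/-- `X = (x, ẋ)`. -/
def X (t : ℝ) : A.Inp := Arch.pair (s.x t) (s.v t)

/-- Tracking error `e = x - x_d`. -/
def e (t : ℝ) : A.Vec := s.x t - p.xd t

/-- `ė = ẋ - ẋ_d`. -/
def edot (t : ℝ) : A.Vec := s.v t - deriv p.xd t

/-- Filtered error `r = ė + α₁ e`. -/
def r (t : ℝ) : A.Vec := s.edot p t + p.α₁ • s.e p t

/-- Control input `u = ẍ_d - Φ(X, θ̂) - k₁ r - e - α₁ ė`. -/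
def u (t : ℝ) : A.Vec :=
  deriv (deriv p.xd) t - p.Φ (s.X t) (s.θh t) - p.k₁ • s.r p t - s.e p t - p.α₁ • s.edot p t

/-- Acceleration `ẍ = f(x, ẋ) + u`. -/
def acc (t : ℝ) : A.Vec := p.f (s.X t) + s.u p t

/-- Parameter estimation error `θ̃ = θ* - θ̂`. -/
def θt (t : ℝ) : A.Par := p.θs - s.θh t

/-- `ζ = (r, e, θ̃)`. -/
def ζ (t : ℝ) : A.Err := Arch.err (s.r p t) (s.e p t) (s.θt p t)

/-- Observer error `r̃ = r - r̂`. -/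
def rt (t : ℝ) : A.Vec := s.r p t - s.rh t

/-- Observer error `Δ̃ = ẍ - Δ̂`. -/
def Δt (t : ℝ) : A.Vec := s.acc p t - s.Δh t

/-- `z = (r̃, Δ̃)`. -/
def z (t : ℝ) : WithLp 2 (A.Vec × A.Vec) := WithLp.toLp 2 (s.rt p t, s.Δt p t)

/-- The data points recorded up to time `t`. -/
def stack (t : ℝ) : Finset (Fin N) := Finset.univ.filter (fun i => s.ts i ≤ t)

/-- `∑ Φ'ᵀ(X_i, θ̂) Φ'(X_i, θ̂)` over the data recorded up to time `t`, with `X_i = X(t_i)` and the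
current estimate `θ̂ = θ̂(t)`. -/
def gram (t : ℝ) : A.Par →L[ℝ] A.Par :=
  ∑ i ∈ s.stack t, (p.JT (s.X (s.ts i)) (s.θh t)).comp (p.J (s.X (s.ts i)) (s.θh t))

/-- The unprojected second concurrent-learning law
`Γ (Φ'ᵀ(X, θ̂) r - γ₂ θ̂ - γ₁ ∑ Φ'ᵀ(X_i, θ̂) (u_i - Δ̂_i + Φ'(X_i, θ̂) θ̂))`. -/
def rawLaw (t : ℝ) : A.Par :=
  s.Γ t (p.JT (s.X t) (s.θh t) (s.r p t) - p.γ₂ • s.θh t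
    - p.γ₁ • ∑ i ∈ s.stack t, p.JT (s.X (s.ts i)) (s.θh t)
        (s.u p (s.ts i) - s.Δh (s.ts i) + p.J (s.X (s.ts i)) (s.θh t) (s.θh t)))

/-- Right-hand side of the weight update law. -/
def θrhs (t : ℝ) : A.Par := proj p.P p.εP (s.Γ t) (s.θh t) (s.rawLaw p t)

open Classical in
/-- Right-hand side of the differential equation for `Γ⁻¹`. -/
def Γrhs (t : ℝ) : A.Par →L[ℝ] A.Par :=
  if p.lΓmin < lamMin (s.Γ t) ∧ lamMax (s.Γ t) < p.lΓmax then
    -(p.β t • s.Γinv t) + p.γ₁ • s.gram p t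
  else 0

open Classical in
/-- Settling time of the observer for the accuracy `δ_Δ`; it is the initial time if the observer
error has this accuracy from the start. -/
def tΔ (δf : ℝ) : ℝ :=
  if ‖s.z p p.t₀‖ ≤ p.δΔ then p.t₀
  else p.t₀ + 1 / p.Λ₁ * Real.log
    ((p.kΔ * p.Λ₁ * ‖s.z p p.t₀‖ ^ 2 - δf ^ 2) / (p.kΔ * p.Λ₁ * p.δΔ ^ 2 - δf ^ 2))

/-- The constant `ι₄`. -/
def ι₄ (ρ₁ ρ₅ : ℝ → ℝ) (εB : ℝ) : ℝ :=
  1 / 2 * εB ^ 2 + p.γ₁ * N * p.δΔ / 2 * ∑ i, ρ₁ ‖s.X (s.ts i)‖ ^ 2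
    + p.γ₁ / 2 * ∑ i, ρ₅ ‖s.X (s.ts i)‖ ^ 2 + p.γ₂ / 2 * p.θB ^ 2

/-- The set `ℋ` of stabilizing initial conditions, with `χ₄ = ρ_δ⁻¹(λ₃ - λ_{3d})`. -/
def H (ρ₁ ρ₅ : ℝ → ℝ) (εB χ₄ lam₃d : ℝ) : Set A.Err :=
  {σ | ‖σ‖ < √(p.β₁ / p.β₂ * χ₄ ^ 2 - s.ι₄ p ρ₁ ρ₅ εB / lam₃d)}

end Signals

/-- The interval `[t₀, b)`, with `b ≤ ∞`. -/
def span (t₀ : ℝ) (b : EReal) : Set ℝ := {t | t₀ ≤ t ∧ (t : EReal) < b}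

/-- `y` is a Carathéodory solution of `ẏ = g` on `[t₀, b)`. -/
def IsCaratheodory {W : Type*} [NormedAddCommGroup W] [NormedSpace ℝ W]
    (t₀ : ℝ) (b : EReal) (y g : ℝ → W) : Prop :=
  ∀ t ∈ span t₀ b, IntervalIntegrable g volume t₀ t ∧ y t = y t₀ + ∫ τ in t₀..t, g τ

/-- The signals form a solution on `[t₀, b)` of the closed loop made of the plant, the controller,
the state-derivative observer and the second concurrent-learning law, with data recorded only after
the settling time of the observer. -/
structure IsClosedLoop {A : Arch} {N : ℕ} (p : Problem A) (s : Signals A N) (b : EReal) (δf : ℝ) :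
    Prop where
  nonempty : (p.t₀ : EReal) < b
  pos : ∀ t ∈ span p.t₀ b, HasDerivWithinAt s.x (s.v t) (span p.t₀ b) t
  vel : ∀ t ∈ span p.t₀ b, HasDerivWithinAt s.v (p.f (s.X t) + s.u p t) (span p.t₀ b) t
  obs_r : ∀ t ∈ span p.t₀ b, HasDerivWithinAt s.rh
    (s.Δh t - deriv (deriv p.xd) t + p.α₁ • s.edot p t + p.α₂ • s.rt p t) (span p.t₀ b) t
  /-- the observer equation `d/dt Δ̂ = r̃ + k_Δ Δ̃ + d/dt u`, written without the derivative
  of `u` -/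
  obs_Δ : ∀ t ∈ span p.t₀ b, HasDerivWithinAt (fun τ => s.Δh τ - s.u p τ)
    (s.rt p t + p.kΔ • s.Δt p t) (span p.t₀ b) t
  θ_init : s.θh p.t₀ ∈ p.Θε
  θ_law : IsCaratheodory p.t₀ b s.θh (s.θrhs p)
  Γ_inv : ∀ t ∈ span p.t₀ b, (s.Γ t).comp (s.Γinv t) = ContinuousLinearMap.id ℝ A.Par ∧
    (s.Γinv t).comp (s.Γ t) = ContinuousLinearMap.id ℝ A.Par
  Γ_init : IsSelfAdjoint (s.Γ p.t₀) ∧ p.lΓmin ≤ lamMin (s.Γ p.t₀) ∧ lamMax (s.Γ p.t₀) ≤ p.lΓmax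
  Γ_law : IsCaratheodory p.t₀ b s.Γinv (s.Γrhs p)
  rec_mem : ∀ i, s.ts i ∈ span p.t₀ b
  rec_late : ∀ i, s.tΔ p δf ≤ s.ts i

end CLDNN

end

/-!
After the settling time the observer reproduces the recorded accelerations up to `δ_Δ`, so that the
stored data measure `Φ'(X_i, θ̂) θ̃` up to an error bounded on the ball `D χ₄`. The projection keeps
`θ̂` in `Θ_ε` and only helps the decay, and `Γ⁻¹` stays between `1 / λ_{Γ,max}` and
`1 / λ_{Γ,min}`. Inside the ball the Lyapunov function
`V = ½ ‖r‖² + ½ ‖e‖² + ½ θ̃ᵀ Γ⁻¹ θ̃` therefore satisfies `V' ≤ -(λ_{3d} / β₂) V + ι₄` almost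
everywhere. A trajectory that starts in `ℋ` has its exponential envelope strictly inside the ball,
hence there is no first time at which it reaches the boundary.
-/

namespace CLDNN

open Set Filter Asymptotics

/-! ### Absolutely continuous functions with an almost everywhere derivative -/

section AbsolutelyContinuous

variable {E F G : Type*} [NormedAddCommGroup E] [NormedSpace ℝ E] [NormedAddCommGroup F]
  [NormedSpace ℝ F] [NormedAddCommGroup G] [NormedSpace ℝ G] {a b c d : ℝ}

theorem absolutelyContinuousOnInterval_of_dist_le {X Y : Type*} [PseudoMetricSpace X]
    [PseudoMetricSpace Y] {f : ℝ → X} {h : ℝ → Y} {K : ℝ}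
    (hh : AbsolutelyContinuousOnInterval h a b)
    (hfh : ∀ x ∈ uIcc a b, ∀ y ∈ uIcc a b, dist (f x) (f y) ≤ K * dist (h x) (h y)) :
    AbsolutelyContinuousOnInterval f a b := by
  refine squeeze_zero' (Eventually.of_forall fun _ => Finset.sum_nonneg fun _ _ => dist_nonneg)
    ?_ (mul_zero K ▸ Tendsto.const_mul K hh)
  filter_upwards [mem_inf_of_right (mem_principal_self _)] with I hI
  rw [Finset.mul_sum]
  exact Finset.sum_le_sum fun i hi => hfh _ (hI.1 i hi).1 _ (hI.1 i hi).2

theorem absolutelyContinuousOnInterval_integral {g : ℝ → E}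
    (hg : IntervalIntegrable g volume a b) :
    AbsolutelyContinuousOnInterval (fun t => ∫ τ in a..t, g τ) a b := by
  refine absolutelyContinuousOnInterval_of_dist_le (K := 1)
    (hg.norm.absolutelyContinuousOnInterval_intervalIntegral left_mem_uIcc) fun u hu v hv => ?_
  have hint : ∀ w ∈ uIcc a b, IntervalIntegrable g volume a w := fun w hw =>
    hg.mono_set (uIcc_subset_uIcc_left hw)
  rw [one_mul, dist_eq_norm, dist_eq_norm,
    intervalIntegral.integral_interval_sub_left (hint u hu) (hint v hv),
    intervalIntegral.integral_interval_sub_left (hint u hu).norm (hint v hv).norm]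
  exact intervalIntegral.norm_integral_le_abs_integral_norm

/-- `y` is absolutely continuous on the interval between `a` and `b`, and its derivative there is
almost everywhere equal to `g`. This is the form in which Carathéodory solutions are
differentiated. -/
structure HasACDeriv (y g : ℝ → E) (a b : ℝ) : Prop where
  ac : AbsolutelyContinuousOnInterval y a b
  hasDerivAt : ∀ᵐ t, t ∈ uIcc a b → HasDerivAt y (g t) t

namespace HasACDeriv

variable {y g : ℝ → E} {z k : ℝ → F}

theorem continuousOn (hy : HasACDeriv y g a b) : ContinuousOn y (uIcc a b) := hy.ac.continuousOn

theorem mono (hy : HasACDeriv y g a b) (h : uIcc c d ⊆ uIcc a b) : HasACDeriv y g c d :=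
  ⟨hy.ac.mono h, hy.hasDerivAt.mono fun _ ht htm => ht (h htm)⟩

theorem congr_deriv {g' : ℝ → E} (hy : HasACDeriv y g a b) (h : ∀ t ∈ uIcc a b, g t = g' t) :
    HasACDeriv y g' a b :=
  ⟨hy.ac, hy.hasDerivAt.mono fun t ht htm => h t htm ▸ ht htm⟩

theorem of_contDiff (hy : ContDiff ℝ 1 y) : HasACDeriv y (deriv y) a b :=
  ⟨hy.contDiffOn.absolutelyContinuousOnInterval,
    .of_forall fun t _ => (hy.differentiable one_ne_zero t).hasDerivAt⟩

theorem const (w : E) : HasACDeriv (fun _ => w) 0 a b :=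
  (of_contDiff contDiff_const).congr_deriv fun t _ => deriv_const t w

theorem of_hasDerivWithinAt (hab : a ≤ b)
    (hy : ∀ t ∈ Icc a b, HasDerivWithinAt y (g t) (Icc a b) t) (hg : ContinuousOn g (Icc a b)) :
    HasACDeriv y g a b := by
  obtain ⟨C, hC⟩ := isCompact_Icc.exists_bound_of_continuousOn hg
  have hlip : LipschitzOnWith C.toNNReal y (uIcc a b) :=
    uIcc_of_le hab ▸ (convex_Icc a b).lipschitzOnWith_of_nnnorm_hasDerivWithin_le hy
      fun t ht => NNReal.coe_le_coe.1 ((hC t ht).trans (Real.le_coe_toNNReal C))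
  refine ⟨hlip.absolutelyContinuousOnInterval, ?_⟩
  filter_upwards [(Ioo_ae_eq_Icc (a := a) (b := b)).mem_iff] with t hmem ht
  rw [uIcc_of_le hab, ← hmem] at ht
  exact (hy t (Ioo_subset_Icc_self ht)).hasDerivAt (Icc_mem_nhds ht.1 ht.2)

theorem add {w h : ℝ → E} (hy : HasACDeriv y g a b) (hw : HasACDeriv w h a b) :
    HasACDeriv (fun t => y t + w t) (fun t => g t + h t) a b := by
  refine ⟨hy.ac.fun_add hw.ac, ?_⟩
  filter_upwards [hy.hasDerivAt, hw.hasDerivAt] with t h1 h2 ht using (h1 ht).add (h2 ht)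

theorem sub {w h : ℝ → E} (hy : HasACDeriv y g a b) (hw : HasACDeriv w h a b) :
    HasACDeriv (fun t => y t - w t) (fun t => g t - h t) a b := by
  refine ⟨hy.ac.fun_sub hw.ac, ?_⟩
  filter_upwards [hy.hasDerivAt, hw.hasDerivAt] with t h1 h2 ht using (h1 ht).sub (h2 ht)

theorem const_sub (w : E) (hy : HasACDeriv y g a b) :
    HasACDeriv (fun t => w - y t) (fun t => -g t) a b := by
  simpa using (const w).sub hy

theorem const_smul (m : ℝ) (hy : HasACDeriv y g a b) :
    HasACDeriv (fun t => m • y t) (fun t => m • g t) a b :=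
  ⟨hy.ac.const_smul m, hy.hasDerivAt.mono fun _ h ht => (h ht).const_smul m⟩

theorem prodMk (hy : HasACDeriv y g a b) (hz : HasACDeriv z k a b) :
    HasACDeriv (fun t => (y t, z t)) (fun t => (g t, k t)) a b := by
  refine ⟨?_, ?_⟩
  · refine squeeze_zero (fun I => Finset.sum_nonneg fun i _ => dist_nonneg) (fun I => ?_)
      (by simpa using Tendsto.add hy.ac hz.ac)
    rw [← Finset.sum_add_distrib]
    exact Finset.sum_le_sum fun i _ => max_le_add_of_nonneg dist_nonneg dist_nonneg
  · filter_upwards [hy.hasDerivAt, hz.hasDerivAt] with t h1 h2 ht using (h1 ht).prodMk (h2 ht)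

theorem comp {φ : E → F} (hφ : ContDiff ℝ 1 φ) (hy : HasACDeriv y g a b) :
    HasACDeriv (fun t => φ (y t)) (fun t => fderiv ℝ φ (y t) (g t)) a b := by
  obtain ⟨K, hK⟩ := (hφ.locallyLipschitz.locallyLipschitzOn
    (s := y '' uIcc a b)).exists_lipschitzOnWith_of_compact
    (isCompact_uIcc.image_of_continuousOn hy.continuousOn)
  refine ⟨absolutelyContinuousOnInterval_of_dist_le hy.ac fun u hu v hv =>
    hK.dist_le_mul _ (mem_image_of_mem _ hu) _ (mem_image_of_mem _ hv), ?_⟩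
  filter_upwards [hy.hasDerivAt] with t h ht
  exact (hφ.differentiable one_ne_zero (y t)).hasFDerivAt.comp_hasDerivAt t (h ht)

theorem clm_comp (φ : E →L[ℝ] F) (hy : HasACDeriv y g a b) :
    HasACDeriv (fun t => φ (y t)) (fun t => φ (g t)) a b := by
  simpa using hy.comp φ.contDiff

theorem bilin (B : E →L[ℝ] F →L[ℝ] G) (hy : HasACDeriv y g a b) (hz : HasACDeriv z k a b) :
    HasACDeriv (fun t => B (y t) (z t)) (fun t => B (y t) (k t) + B (g t) (z t)) a b :=
  ((hy.prodMk hz).comp B.isBoundedBilinearMap.contDiff).congr_deriv fun t _ => by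
    rw [B.isBoundedBilinearMap.fderiv]; rfl

theorem clm_apply {L k : ℝ → E →L[ℝ] F} (hL : HasACDeriv L k a b) (hy : HasACDeriv y g a b) :
    HasACDeriv (fun t => L t (y t)) (fun t => L t (g t) + k t (y t)) a b :=
  hL.bilin (.id ℝ (E →L[ℝ] F)) hy

theorem mul {u v h k : ℝ → ℝ} (hu : HasACDeriv u h a b) (hv : HasACDeriv v k a b) :
    HasACDeriv (fun t => u t * v t) (fun t => u t * k t + h t * v t) a b :=
  hu.bilin (.mul ℝ ℝ) hv

theorem inner {H : Type*} [NormedAddCommGroup H] [InnerProductSpace ℝ H] {y g z k : ℝ → H}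
    (hy : HasACDeriv y g a b) (hz : HasACDeriv z k a b) :
    HasACDeriv (fun t => Inner.inner ℝ (y t) (z t))
      (fun t => Inner.inner ℝ (y t) (k t) + Inner.inner ℝ (g t) (z t)) a b :=
  hy.bilin (innerSL ℝ) hz

theorem eq_of_forall_eq_zero (hab : a ≤ b) (hy : HasACDeriv y g a b)
    (hg : ∀ t ∈ Ioo a b, g t = 0) : y b = y a := by
  have hzero : ∀ᵐ t, t ∈ uIcc a b → HasDerivAt y 0 t := by
    filter_upwards [hy.hasDerivAt, (Ioo_ae_eq_Icc (a := a) (b := b)).mem_iff] with t h hmem ht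
    exact hg t (hmem.2 (uIcc_of_le hab ▸ ht)) ▸ h ht
  obtain ⟨C, hC⟩ := hy.ac.const_of_ae_hasDerivAt_zero hzero
  rw [hC a left_mem_uIcc, hC b right_mem_uIcc]

theorem le_of_nonpos {v g : ℝ → ℝ} (hab : a ≤ b) (hv : HasACDeriv v g a b)
    (hg : ∀ t ∈ Ioo a b, g t ≤ 0) : v b ≤ v a := by
  have hle : ∫ t in a..b, deriv v t ≤ 0 := by
    rw [intervalIntegral.integral_of_le hab, integral_Ioc_eq_integral_Ioo]
    refine setIntegral_nonpos_ae measurableSet_Ioo ?_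
    filter_upwards [hv.hasDerivAt] with t h ht
    exact (h (uIcc_of_le hab ▸ Ioo_subset_Icc_self ht)).deriv.trans_le (hg t ht)
  linarith [hv.ac.integral_deriv_eq_sub]

theorem le_exp_of_le {v g : ℝ → ℝ} (hab : a ≤ b) (hc : 0 < c)
    (hv : HasACDeriv v g a b) (hg : ∀ t ∈ Ioo a b, g t ≤ -c * v t + d) :
    v b ≤ v a * Real.exp (-c * (b - a)) + d / c * (1 - Real.exp (-c * (b - a))) := by
  have hexp : HasACDeriv (fun t => Real.exp (c * (t - a))) (fun t => Real.exp (c * (t - a)) * c)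
      a b :=
    (of_contDiff (by fun_prop)).congr_deriv fun t _ => by
      simpa using (((hasDerivAt_id t).sub_const a).const_mul c).exp.deriv
  have hle := (hexp.mul (hv.sub (const (d / c)))).le_of_nonpos hab fun t ht => by
    have hfactor : Real.exp (c * (t - a)) * (g t - 0) + Real.exp (c * (t - a)) * c * (v t - d / c)
        = Real.exp (c * (t - a)) * (g t - (-c * v t + d)) := by field_simp; ring
    exact hfactor.trans_le
      (mul_nonpos_of_nonneg_of_nonpos (Real.exp_pos _).le (sub_nonpos.2 (hg t ht)))
  rw [sub_self, mul_zero, Real.exp_zero, one_mul, mul_comm, ← le_div_iff₀ (Real.exp_pos _),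
    div_eq_mul_inv _ (Real.exp _), ← Real.exp_neg, ← neg_mul] at hle
  linarith

end HasACDeriv

theorem le_exp_of_hasDerivWithinAt_le {v g : ℝ → ℝ} (hab : a ≤ b) (hc : 0 < c)
    (hv : ∀ t ∈ Icc a b, HasDerivWithinAt v (g t) (Icc a b) t)
    (hg : ∀ t ∈ Icc a b, g t ≤ -c * v t + d) :
    v b ≤ v a * Real.exp (-c * (b - a)) + d / c * (1 - Real.exp (-c * (b - a))) := by
  have hslope : ∀ t ∈ Ico a b, HasDerivWithinAt v (g t) (Ici t) t := fun t ht =>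
    (hv t (Ico_subset_Icc_self ht)).mono_of_mem_nhdsWithin
      (mem_of_superset (Icc_mem_nhdsGE ht.2) (Icc_subset_Icc_left ht.1))
  have h := le_gronwallBound_of_liminf_deriv_right_le
    (fun t ht => (hv t ht).continuousWithinAt) (fun t ht _ => (hslope t ht).liminf_right_slope_le)
    le_rfl (fun t ht => hg t (Ico_subset_Icc_self ht)) b (right_mem_Icc.2 hab)
  rw [gronwallBound_of_K_ne_0 (neg_ne_zero.2 hc.ne'), div_neg] at h
  linarith

theorem span_of_le {t₀ t τ : ℝ} {b : EReal} (ht : t ∈ span t₀ b) (h0 : t₀ ≤ τ) (h1 : τ ≤ t) :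
    τ ∈ span t₀ b :=
  ⟨h0, (EReal.coe_le_coe_iff.2 h1).trans_lt ht.2⟩

theorem Icc_subset_span {t₀ t : ℝ} {b : EReal} (ht : t ∈ span t₀ b) : Icc t₀ t ⊆ span t₀ b :=
  fun _ hτ => span_of_le ht hτ.1 hτ.2

theorem continuousOn_span {X : Type*} [TopologicalSpace X] {t₀ : ℝ} {b : EReal} {y : ℝ → X}
    (hy : ∀ t ∈ span t₀ b, ContinuousOn y (Icc t₀ t)) : ContinuousOn y (span t₀ b) := fun t ht => by
  obtain ⟨c, htc, hcb⟩ := EReal.lt_iff_exists_real_btwn.1 ht.2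
  have htc : t < c := EReal.coe_lt_coe_iff.1 htc
  refine (hy c ⟨ht.1.trans htc.le, hcb⟩ t ⟨ht.1, htc.le⟩).mono_of_mem_nhdsWithin ?_
  filter_upwards [self_mem_nhdsWithin, mem_nhdsWithin_of_mem_nhds (Iio_mem_nhds htc)] with τ h1 h2
  exact ⟨h1.1, h2.le⟩

section IsCaratheodory

variable [CompleteSpace E] {t₀ : ℝ} {b : EReal} {y g : ℝ → E}

theorem IsCaratheodory.hasACDeriv (h : IsCaratheodory t₀ b y g) {t : ℝ} (ht : t ∈ span t₀ b) :
    HasACDeriv y g t₀ t := by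
  have heq : ∀ τ ∈ uIcc t₀ t, y τ = y t₀ + ∫ s in t₀..τ, g s := fun τ hτ =>
    (h τ (Icc_subset_span ht (uIcc_of_le ht.1 ▸ hτ))).2
  refine ⟨absolutelyContinuousOnInterval_of_dist_le
    (absolutelyContinuousOnInterval_integral (h t ht).1) (K := 1) fun u hu v hv => ?_, ?_⟩
  · rw [heq u hu, heq v hv, dist_add_left, one_mul]
  · filter_upwards [(h t ht).1.ae_hasDerivAt_integral,
      (Ioo_ae_eq_Icc (a := t₀) (b := t)).mem_iff] with τ hderiv hmem hτ
    refine ((hderiv hτ t₀ left_mem_uIcc).const_add (y t₀)).congr_of_eventuallyEq ?_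
    rw [uIcc_of_le ht.1] at heq hτ
    filter_upwards [Icc_mem_nhds (hmem.2 hτ).1 (hmem.2 hτ).2] with w hw using heq w hw

theorem IsCaratheodory.continuousOn (h : IsCaratheodory t₀ b y g) : ContinuousOn y (span t₀ b) :=
  continuousOn_span fun t ht => by simpa [uIcc_of_le ht.1] using (h.hasACDeriv ht).continuousOn

end IsCaratheodory

end AbsolutelyContinuous

/-! ### Quadratic forms of operators -/

section Operators

variable {W : Type*} [NormedAddCommGroup W] [InnerProductSpace ℝ W] {B G Gi : W →L[ℝ] W} {l M : ℝ}

/-- The Cauchy–Schwarz inequality for the form of `B`, applied to `y` and `B y`, read off from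
`0 ≤ ⟪B v, v⟫` at `v = M • y - B y`. -/
theorem norm_sq_apply_le_of_inner_le (hM : 0 < M) (hsymm : B.IsSymmetric)
    (hnonneg : ∀ w, 0 ≤ inner ℝ (B w) w) (hle : ∀ w, inner ℝ (B w) w ≤ M * ‖w‖ ^ 2) (y : W) :
    ‖B y‖ ^ 2 ≤ M * inner ℝ (B y) y := by
  have hform := hnonneg (M • y - B y)
  have hBB : inner ℝ (B (B y)) y = ‖B y‖ ^ 2 :=
    (hsymm (B y) y).trans (real_inner_self_eq_norm_sq _)
  simp only [map_sub, map_smul, inner_sub_left, inner_sub_right, real_inner_smul_left,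
    real_inner_smul_right, real_inner_self_eq_norm_sq, hBB] at hform
  refine le_of_mul_le_mul_left ?_ hM
  linarith [hle (B y)]

theorem opNorm_le_of_inner_le (hM : 0 < M) (hsymm : B.IsSymmetric)
    (hnonneg : ∀ w, 0 ≤ inner ℝ (B w) w) (hle : ∀ w, inner ℝ (B w) w ≤ M * ‖w‖ ^ 2) : ‖B‖ ≤ M :=
  B.opNorm_le_bound hM.le fun y => abs_le_of_sq_le_sq' (by
    calc ‖B y‖ ^ 2 ≤ M * inner ℝ (B y) y := norm_sq_apply_le_of_inner_le hM hsymm hnonneg hle y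
      _ ≤ M * (M * ‖y‖ ^ 2) := mul_le_mul_of_nonneg_left (hle y) hM.le
      _ = (M * ‖y‖) ^ 2 := by ring) (by positivity) |>.2

theorem le_inner_inv (hM : 0 < M) (hsymm : G.IsSymmetric) (hinv : ∀ w, G (Gi w) = w)
    (hnonneg : ∀ w, 0 ≤ inner ℝ (G w) w) (hle : ∀ w, inner ℝ (G w) w ≤ M * ‖w‖ ^ 2) (w : W) :
    1 / M * ‖w‖ ^ 2 ≤ inner ℝ (Gi w) w := by
  have h := norm_sq_apply_le_of_inner_le hM hsymm hnonneg hle (Gi w)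
  rwa [hinv, real_inner_comm, ← div_le_iff₀' hM, ← one_div_mul_eq_div] at h

theorem inner_inv_le (hl : 0 < l) (hinv : ∀ w, G (Gi w) = w)
    (hle : ∀ w, l * ‖w‖ ^ 2 ≤ inner ℝ (G w) w) (w : W) :
    inner ℝ (Gi w) w ≤ 1 / l * ‖w‖ ^ 2 := by
  have hform := hle (Gi w)
  rw [hinv, real_inner_comm] at hform
  rw [one_div_mul_eq_div, le_div_iff₀ hl]
  nlinarith [real_inner_le_norm (Gi w) w, sq_nonneg (l * ‖Gi w‖ - ‖w‖)]

theorem opNorm_le_of_le_inner_inv (hM : 0 < M) (hinv : ∀ w, Gi (G w) = w)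
    (hle : ∀ w, 1 / M * ‖w‖ ^ 2 ≤ inner ℝ (Gi w) w) : ‖G‖ ≤ M := by
  refine G.opNorm_le_bound hM.le fun y => ?_
  have h := (hle (G y)).trans (real_inner_le_norm _ _)
  rw [hinv, one_div_mul_eq_div, div_le_iff₀ hM] at h
  rcases (norm_nonneg (G y)).eq_or_lt with h0 | hpos
  · exact h0 ▸ by positivity
  · exact le_of_mul_le_mul_right (by linarith) hpos

theorem inner_apply_pos_of_le_inner_inv (hM : 0 < M) (hinv : ∀ w, Gi (G w) = w)
    (hle : ∀ w, 1 / M * ‖w‖ ^ 2 ≤ inner ℝ (Gi w) w) {w : W} (hw : w ≠ 0) :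
    0 < inner ℝ w (G w) := by
  have hGw : G w ≠ 0 := fun h0 => hw (by rw [← hinv w, h0, map_zero])
  calc 0 < 1 / M * ‖G w‖ ^ 2 := by positivity
    _ ≤ inner ℝ (Gi (G w)) (G w) := hle (G w)
    _ = inner ℝ w (G w) := by rw [hinv]

section Spectrum

variable [FiniteDimensional ℝ W]

theorem eigenvalues_mem_spectrum (hB : B.IsSymmetric) (i : Fin (Module.finrank ℝ W)) :
    hB.eigenvalues rfl i ∈ spectrum ℝ B := by
  rw [← AlgEquiv.spectrum_eq (Module.End.toContinuousLinearMap W).symm]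
  exact (hB.hasEigenvalue_eigenvalues rfl i).mem_spectrum

theorem inner_apply_eq_sum_eigenvalues (hB : B.IsSymmetric) (w : W) :
    inner ℝ (B w) w =
      ∑ i, hB.eigenvalues rfl i * inner ℝ (hB.eigenvectorBasis rfl i) w ^ 2 := by
  rw [← (hB.eigenvectorBasis rfl).sum_inner_mul_inner]
  refine Finset.sum_congr rfl fun i _ => ?_
  have heig : inner ℝ (B w) (hB.eigenvectorBasis rfl i)
      = hB.eigenvalues rfl i * inner ℝ w (hB.eigenvectorBasis rfl i) := by
    rw [← ContinuousLinearMap.coe_coe, hB, hB.apply_eigenvectorBasis, real_inner_smul_right]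
    rfl
  rw [heig, real_inner_comm w]
  ring

theorem lamMin_mul_le_inner (hB : B.IsSymmetric) (w : W) :
    lamMin B * ‖w‖ ^ 2 ≤ inner ℝ (B w) w := by
  have := FiniteDimensional.complete ℝ W
  rw [inner_apply_eq_sum_eigenvalues hB, ← (hB.eigenvectorBasis rfl).sum_sq_inner_right w,
    Finset.mul_sum]
  gcongr with i
  exact csInf_le (spectrum.isCompact B).bddBelow (eigenvalues_mem_spectrum hB i)

theorem inner_le_lamMax_mul (hB : B.IsSymmetric) (w : W) :
    inner ℝ (B w) w ≤ lamMax B * ‖w‖ ^ 2 := by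
  have := FiniteDimensional.complete ℝ W
  rw [inner_apply_eq_sum_eigenvalues hB, ← (hB.eigenvectorBasis rfl).sum_sq_inner_right w,
    Finset.mul_sum]
  gcongr with i
  exact le_csSup (spectrum.isCompact B).bddAbove (eigenvalues_mem_spectrum hB i)

end Spectrum

end Operators

/-! ### Convex functions and the smooth projection -/

section Convex

variable {W : Type*} [NormedAddCommGroup W]

theorem fderiv_apply_sub_le_of_convexOn [NormedSpace ℝ W] {P : W → ℝ} (hP : ConvexOn ℝ univ P)
    {θ : W} (hd : DifferentiableAt ℝ P θ) (w : W) : fderiv ℝ P θ (w - θ) ≤ P w - P θ := by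
  have hline : HasDerivAt (P ∘ AffineMap.lineMap θ w) (fderiv ℝ P θ (w - θ)) (0 : ℝ) := by
    refine HasFDerivAt.comp_hasDerivAt (0 : ℝ) ?_ AffineMap.hasDerivAt_lineMap
    simpa using hd.hasFDerivAt
  simpa [slope_def_field] using (hP.comp_affineMap (AffineMap.lineMap θ w)).le_slope_of_hasDerivAt
    (mem_univ 0) (mem_univ 1) one_pos hline

/-- Contracting `{P ≤ c}` by the factor `q` towards a point `θ₀` with `P θ₀ < c₀` maps it into
`{P ≤ c₀}`. -/
theorem isBounded_sublevel_of_convexOn [NormedSpace ℝ W] {P : W → ℝ} (hP : ConvexOn ℝ univ P)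
    {c₀ c : ℝ} (hb : Bornology.IsBounded {θ | P θ ≤ c₀}) (hs : ∃ θ, P θ < c₀) :
    Bornology.IsBounded {θ | P θ ≤ c} := by
  obtain ⟨θ₀, h₀⟩ := hs
  rcases le_or_gt c c₀ with hc | hc
  · exact hb.subset fun θ hθ => le_trans hθ hc
  obtain ⟨q, hq⟩ : ∃ q, q = (c₀ - P θ₀) / (c - P θ₀) := ⟨_, rfl⟩
  have hq₀ : 0 < q := hq ▸ div_pos (by linarith) (by linarith)
  have hq₁ : q ≤ 1 := hq ▸ (div_le_one (by linarith)).2 (by linarith)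
  have hqc : q * (c - P θ₀) = c₀ - P θ₀ := hq ▸ div_mul_cancel₀ _ (by linarith)
  refine ((hb.sub (t := {(1 - q) • θ₀}) Bornology.isBounded_singleton).smul₀ q⁻¹).subset
    fun θ (hθ : P θ ≤ c) => ?_
  have hcontract : P ((1 - q) • θ₀ + q • θ) ≤ c₀ :=
    calc P ((1 - q) • θ₀ + q • θ) ≤ (1 - q) * P θ₀ + q * P θ :=
          hP.2 (mem_univ θ₀) (mem_univ θ) (sub_nonneg.2 hq₁) hq₀.le (by ring)
      _ ≤ (1 - q) * P θ₀ + q * c := by gcongr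
      _ = c₀ := by linear_combination hqc
  exact ⟨q • θ, ⟨_, hcontract, _, rfl, add_sub_cancel_left _ _⟩, inv_smul_smul₀ hq₀.ne' θ⟩

variable [InnerProductSpace ℝ W] [CompleteSpace W]

theorem inner_gradient_proj_nonpos {P : W → ℝ} {ε : ℝ} (hε : 0 < ε) {G : W →L[ℝ] W} {θ : W}
    (hG : gradient P θ ≠ 0 → 0 < inner ℝ (gradient P θ) (G (gradient P θ))) (hθ : ε ≤ P θ)
    (τ : W) : inner ℝ (gradient P θ) (proj P ε G θ τ) ≤ 0 := by
  unfold proj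
  split_ifs with h
  · exact h.resolve_left (hε.trans_le hθ).not_ge
  · have hne : gradient P θ ≠ 0 := fun h0 => h (.inr (by rw [h0, inner_zero_left]))
    rw [min_eq_left ((one_le_div hε).2 hθ), one_mul, inner_sub_right, real_inner_smul_right,
      div_mul_cancel₀ _ (hG hne).ne', sub_self]

theorem inner_inv_le_inner_inv_proj {P : W → ℝ} (hP : ConvexOn ℝ univ P) {ε : ℝ} (hε : 0 < ε)
    {G Gi : W →L[ℝ] W} {θ w : W} (hd : DifferentiableAt ℝ P θ) (hinv : ∀ w, Gi (G w) = w)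
    (hG : 0 ≤ inner ℝ (gradient P θ) (G (gradient P θ))) (hw : P w ≤ 0) (τ : W) :
    inner ℝ (w - θ) (Gi τ) ≤ inner ℝ (w - θ) (Gi (proj P ε G θ τ)) := by
  unfold proj
  split_ifs with h
  · exact le_rfl
  · obtain ⟨hPθ, hτ⟩ : 0 < P θ ∧ 0 < inner ℝ (gradient P θ) τ := by simpa using h
    have hgrad : inner ℝ (w - θ) (gradient P θ) ≤ 0 := by
      rw [real_inner_comm, gradient, InnerProductSpace.toDual_symm_apply]
      linarith [fderiv_apply_sub_le_of_convexOn hP hd w]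
    have hcoef : 0 ≤ min 1 (P θ / ε) *
        (inner ℝ (gradient P θ) τ / inner ℝ (gradient P θ) (G (gradient P θ))) := by positivity
    rw [map_sub, map_smul, hinv, inner_sub_right, real_inner_smul_right]
    linarith [mul_nonpos_of_nonneg_of_nonpos hcoef hgrad]

end Convex

/-! ### Closed conditions along an interval -/

section Continuation

variable {a b : ℝ}

theorem exists_last_mem {S : Set ℝ} (hS : IsClosed (Icc a b ∩ S)) (hab : a ≤ b)
    (ha : a ∈ S) (hb : b ∉ S) : ∃ c ∈ Ico a b, c ∈ S ∧ ∀ t ∈ Ioc c b, t ∉ S := by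
  obtain ⟨c, ⟨hcab, hcS⟩, hmax⟩ := (isCompact_Icc.of_isClosed_subset hS
    inter_subset_left).exists_isGreatest ⟨a, left_mem_Icc.2 hab, ha⟩
  refine ⟨c, ⟨hcab.1, hcab.2.lt_of_ne fun h => hb (h ▸ hcS)⟩, hcS, fun t ht htS => ?_⟩
  exact ht.1.not_ge (hmax ⟨⟨hcab.1.trans ht.1.le, ht.2⟩, htS⟩)

theorem forall_lt_of_forall_le_imp_lt {g : ℝ → ℝ} {χ : ℝ} (hg : ContinuousOn g (Icc a b))
    (ha : g a ≤ χ) (hstep : ∀ c ∈ Icc a b, (∀ t ∈ Icc a c, g t ≤ χ) → g c < χ) :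
    ∀ t ∈ Icc a b, g t < χ := by
  by_contra! ⟨t, ht, hχt⟩
  obtain ⟨c, ⟨hc, hχc⟩, hmin⟩ := (isCompact_Icc.of_isClosed_subset
    (hg.preimage_isClosed_of_isClosed isClosed_Icc (isClosed_Ici (a := χ)))
    inter_subset_left).exists_isLeast ⟨t, ht, hχt⟩
  have hbefore : ∀ τ ∈ Ico a c, g τ < χ := fun τ hτ =>
    not_le.1 fun hχτ => hτ.2.not_ge (hmin ⟨⟨hτ.1, hτ.2.le.trans hc.2⟩, hχτ⟩)
  have hle : ∀ τ ∈ Icc a c, g τ ≤ χ := by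
    rcases hc.1.eq_or_lt with rfl | hac
    · simpa using ha
    · rw [← closure_Ico hac.ne]
      exact fun τ hτ => le_on_closure (fun σ hσ => (hbefore σ hσ).le)
        ((hg.mono (Icc_subset_Icc_right hc.2)).mono (closure_Ico hac.ne).subset)
        continuousOn_const hτ
  exact (hstep c hc hle).not_ge hχc

end Continuation

/-! ### Bounds on the network -/

theorem norm_sub_sub_le_of_hasFDerivWithinAt {E F : Type*} [NormedAddCommGroup E] [NormedSpace ℝ E]
    [NormedAddCommGroup F] [NormedSpace ℝ F] {f : E → F} {f' : E → E →L[ℝ] F}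
    {f'' : E → E →L[ℝ] E →L[ℝ] F} {K : Set E} (hK : Convex ℝ K) {M : ℝ}
    (hf : ∀ v ∈ K, HasFDerivWithinAt f (f' v) K v)
    (hf' : ∀ v ∈ K, HasFDerivWithinAt f' (f'' v) K v) (hM : ∀ v ∈ K, ‖f'' v‖ ≤ M)
    {x y : E} (hx : x ∈ K) (hy : y ∈ K) : ‖f y - f x - f' x (y - x)‖ ≤ M * ‖y - x‖ ^ 2 := by
  have hM0 : 0 ≤ M := (ContinuousLinearMap.opNorm_nonneg _).trans (hM x hx)
  have hseg : segment ℝ x y ⊆ K := hK.segment_subset hx hy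
  have hbound : ∀ v ∈ segment ℝ x y, ‖f' v - f' x‖ ≤ M * ‖y - x‖ := fun v hv =>
    (hK.norm_image_sub_le_of_norm_hasFDerivWithin_le hf' hM hx (hseg hv)).trans
      (mul_le_mul_of_nonneg_left (norm_sub_le_of_mem_segment hv) hM0)
  rw [pow_two, ← mul_assoc]
  exact (convex_segment x y).norm_image_sub_le_of_norm_hasFDerivWithin_le'
    (fun v hv => (hf v (hseg hv)).mono hseg) hbound (left_mem_segment ℝ x y)
    (right_mem_segment ℝ x y)

namespace Arch

variable {A : Arch}

theorem norm_sq_pair (x v : A.Vec) : ‖pair x v‖ ^ 2 = ‖x‖ ^ 2 + ‖v‖ ^ 2 := by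
  simp [EuclideanSpace.norm_sq_eq, pair, Fin.sum_univ_add, -Fin.natAdd_eq_addNat]

theorem norm_pair_le (x v : A.Vec) : ‖pair x v‖ ≤ ‖x‖ + ‖v‖ :=
  abs_le_of_sq_le_sq' (by
    rw [norm_sq_pair, add_sq]
    linarith [mul_nonneg (norm_nonneg x) (norm_nonneg v)]) (by positivity) |>.2

theorem norm_fst_le_norm_pair (x v : A.Vec) : ‖x‖ ≤ ‖pair x v‖ :=
  le_of_sq_le_sq (by linarith [norm_sq_pair x v, sq_nonneg ‖v‖]) (norm_nonneg _)

theorem norm_snd_le_norm_pair (x v : A.Vec) : ‖v‖ ≤ ‖pair x v‖ :=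
  le_of_sq_le_sq (by linarith [norm_sq_pair x v, sq_nonneg ‖x‖]) (norm_nonneg _)

theorem norm_sq_err (r e : A.Vec) (w : A.Par) :
    ‖err r e w‖ ^ 2 = ‖r‖ ^ 2 + ‖e‖ ^ 2 + ‖w‖ ^ 2 := by
  rw [err, WithLp.prod_norm_sq_eq_of_L2, WithLp.prod_norm_sq_eq_of_L2, ← add_assoc]
  rfl

theorem norm_fst_le_norm_err (r e : A.Vec) (w : A.Par) : ‖r‖ ≤ ‖err r e w‖ :=
  WithLp.norm_fst_le _ (err r e w)

theorem norm_snd_le_norm_err (r e : A.Vec) (w : A.Par) : ‖e‖ ≤ ‖err r e w‖ :=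
  (WithLp.norm_fst_le _ (err r e w).snd).trans (WithLp.norm_snd_le _ (err r e w))

theorem norm_thd_le_norm_err (r e : A.Vec) (w : A.Par) : ‖w‖ ≤ ‖err r e w‖ :=
  (WithLp.norm_snd_le _ (err r e w).snd).trans (WithLp.norm_snd_le _ (err r e w))

/-- Concatenation as a continuous linear map, for the calculus of the network input. -/
noncomputable def pairL : A.Vec × A.Vec →L[ℝ] A.Inp :=
  LinearMap.toContinuousLinearMap
    { toFun := fun q => pair q.1 q.2
      map_add' := fun q q' => by
        ext i
        refine Fin.addCases (fun j => ?_) (fun j => ?_) i <;> simp [pair, -Fin.natAdd_eq_addNat]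
      map_smul' := fun c q => by
        ext i
        refine Fin.addCases (fun j => ?_) (fun j => ?_) i <;> simp [pair, -Fin.natAdd_eq_addNat] }

theorem contDiff_mulVec_weight {j : ℕ} {q : A.Inp × A.Par → Fin (A.L j) → ℝ} (hq : ContDiff ℝ ∞ q) :
    ContDiff ℝ ∞ fun z : A.Inp × A.Par => Matrix.mulVec (weight z.2 j).transpose (q z) := by
  refine contDiff_pi.2 fun b => ?_
  simp only [Matrix.mulVec, dotProduct, Matrix.transpose_apply, weight]
  refine ContDiff.sum fun a _ => ContDiff.mul ?_ (contDiff_pi.1 hq a)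
  split_ifs <;> fun_prop

theorem contDiff_layer {ς : ℕ → ℕ → ℝ → ℝ}
    (hς : ∀ j i, 1 ≤ j → j ≤ A.k → ContDiff ℝ ∞ (ς j i)) :
    ∀ j ≤ A.k, ContDiff ℝ ∞ (fun q : A.Inp × A.Par => layer ς q.1 q.2 j)
  | 0, _ => contDiff_mulVec_weight <| contDiff_pi.2 fun i => by
    simp only [augment]
    split_ifs <;> fun_prop
  | j + 1, hj => contDiff_mulVec_weight <| contDiff_pi.2 fun i => by
    simp only [act]
    split_ifs
    · fun_prop
    · exact (hς (j + 1) i (by omega) hj).comp (contDiff_pi.1 (contDiff_layer hς j (by omega)) i)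

theorem layer_zero (ς : ℕ → ℕ → ℝ → ℝ) (X : A.Inp) (j : ℕ) : layer ς X (0 : A.Par) j = 0 := by
  have h : ∀ j, weight (0 : A.Par) j = 0 := fun j => by
    ext a b
    simp [weight]
  cases j <;> simp [layer, h]

end Arch

namespace Problem

section IncrNonneg

variable {ρ ρ' : ℝ → ℝ}

theorem IncrNonneg.mul (h : IncrNonneg ρ) (h' : IncrNonneg ρ') :
    IncrNonneg (fun s => ρ s * ρ' s) :=
  ⟨fun a ha _ hb hab => mul_lt_mul'' (h.1 ha hb hab) (h'.1 ha hb hab) (h.2 a ha) (h'.2 a ha),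
    fun s hs => mul_nonneg (h.2 s hs) (h'.2 s hs)⟩

theorem IncrNonneg.comp_affine (h : IncrNonneg ρ) {m c : ℝ} (hm : 0 < m) (hc : 0 ≤ c) :
    IncrNonneg (fun s => ρ (m * s + c)) := by
  have h0 : ∀ s, 0 ≤ s → 0 ≤ m * s + c := fun s hs => by positivity
  exact ⟨fun a ha b hb hab => h.1 (h0 a ha) (h0 b hb) (by gcongr), fun s hs => h.2 _ (h0 s hs)⟩

theorem IncrNonneg.le (h : IncrNonneg ρ) {a b : ℝ} (ha : 0 ≤ a) (hab : a ≤ b) : ρ a ≤ ρ b :=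
  h.1.monotoneOn ha (ha.trans hab : (0 : ℝ) ≤ b) hab

theorem exists_incrNonneg_bound {E F : Type*} [NormedAddCommGroup E] [ProperSpace E]
    [TopologicalSpace F] {g : E × F → ℝ} (hg : Continuous g) {K : Set F} (hK : IsCompact K) :
    ∃ ρ, IncrNonneg ρ ∧ ∀ X, ∀ θ ∈ K, g (X, θ) ≤ ρ ‖X‖ := by
  let S : ℝ → Set ℝ := fun s => insert 0 (g '' (Metric.closedBall 0 s ×ˢ K))
  have hS : ∀ s, BddAbove (S s) := fun s =>
    (((isCompact_closedBall (0 : E) s).prod hK).image hg).bddAbove.insert 0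
  have hmono : Monotone S := fun a b hab => insert_subset_insert
    (image_mono (prod_mono (Metric.closedBall_subset_closedBall hab) subset_rfl))
  refine ⟨fun s => s + sSup (S s), ⟨fun a _ b _ hab => ?_, fun s hs => ?_⟩, fun X θ hθ => ?_⟩
  · exact add_lt_add_of_lt_of_le hab
      (csSup_le_csSup (hS b) (insert_nonempty _ _) (hmono hab.le))
  · exact add_nonneg hs (le_csSup (hS s) (mem_insert _ _))
  · exact le_add_of_nonneg_of_le (norm_nonneg X)
      (le_csSup (hS _) (mem_insert_of_mem _ (mem_image_of_mem g ⟨by simp, hθ⟩)))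

end IncrNonneg

variable {A : Arch} (p : Problem A)

theorem contDiff_Φ : ContDiff ℝ ∞ (fun q : A.Inp × A.Par => p.Φ q.1 q.2) :=
  (PiLp.contDiff_toLp (𝕜 := ℝ) (p := 2)).comp (Arch.contDiff_layer p.ς_smooth A.k le_rfl)

theorem Φ_zero (X : A.Inp) : p.Φ X 0 = 0 := by
  simp [Φ, Arch.layer_zero]

theorem contDiff_J : ContDiff ℝ ∞ (fun q : A.Inp × A.Par => p.J q.1 q.2) :=
  ContDiff.fderiv (f := fun (q : A.Inp × A.Par) (w : A.Par) => p.Φ q.1 w) (m := ∞)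
    (p.contDiff_Φ.comp (f := fun z : (A.Inp × A.Par) × A.Par => (z.1.1, z.2)) (by fun_prop))
    contDiff_snd le_rfl

/-- The second derivative of the network in the weights, which controls the remainder `rem` of the
first-order expansion. -/
noncomputable def J₂ (X : A.Inp) (θ : A.Par) : A.Par →L[ℝ] A.Par →L[ℝ] A.Vec :=
  fderiv ℝ (fun w => p.J X w) θ

theorem contDiff_J₂ : ContDiff ℝ ∞ (fun q : A.Inp × A.Par => p.J₂ q.1 q.2) :=
  ContDiff.fderiv (f := fun (q : A.Inp × A.Par) (w : A.Par) => p.J q.1 w) (m := ∞)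
    (p.contDiff_J.comp (f := fun z : (A.Inp × A.Par) × A.Par => (z.1.1, z.2)) (by fun_prop))
    contDiff_snd le_rfl

theorem hasFDerivAt_Φ (X : A.Inp) (θ : A.Par) : HasFDerivAt (fun w => p.Φ X w) (p.J X θ) θ :=
  ((p.contDiff_Φ.comp (contDiff_prodMk_right X)).differentiable (by simp) θ).hasFDerivAt

theorem hasFDerivAt_J (X : A.Inp) (θ : A.Par) : HasFDerivAt (fun w => p.J X w) (p.J₂ X θ) θ :=
  ((p.contDiff_J.comp (contDiff_prodMk_right X)).differentiable (by simp) θ).hasFDerivAt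

theorem continuous_Φ : Continuous (fun q : A.Inp × A.Par => p.Φ q.1 q.2) := p.contDiff_Φ.continuous

theorem continuous_J : Continuous (fun q : A.Inp × A.Par => p.J q.1 q.2) := p.contDiff_J.continuous

theorem continuous_JT : Continuous (fun q : A.Inp × A.Par => p.JT q.1 q.2) :=
  ContinuousLinearMap.adjoint.continuous.comp p.continuous_J

theorem norm_JT (X : A.Inp) (θ : A.Par) : ‖p.JT X θ‖ = ‖p.J X θ‖ :=
  ContinuousLinearMap.adjoint.norm_map _

theorem inner_JT (X : A.Inp) (θ w : A.Par) (y : A.Vec) :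
    inner ℝ w (p.JT X θ y) = inner ℝ (p.J X θ w) y :=
  ContinuousLinearMap.adjoint_inner_right _ _ _

theorem convex_Θε : Convex ℝ p.Θε := by
  simpa [Θε] using p.P_convex.convex_le p.εP

theorem isCompact_Θε : IsCompact p.Θε :=
  Metric.isCompact_of_isClosed_isBounded (isClosed_le p.P_C1.continuous continuous_const)
    (isBounded_sublevel_of_convexOn p.P_convex p.P_compact.isBounded p.P_slater)

theorem θs_mem_Θε : p.θs ∈ p.Θε := p.θs_mem.trans p.εP_pos.le

theorem norm_θs_le : ‖p.θs‖ ≤ p.θB :=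
  le_csSup (p.P_compact.image continuous_norm).bddAbove (mem_image_of_mem _ p.θs_mem)

theorem xdB_nonneg : 0 ≤ p.xdB := (norm_nonneg _).trans (p.xd_le p.t₀ le_rfl)

theorem xdB'_nonneg : 0 ≤ p.xdB' := (norm_nonneg _).trans (p.xd'_le p.t₀ le_rfl)

theorem norm_inputOf_le {t : ℝ} (ht : p.t₀ ≤ t) (r e : A.Vec) (w : A.Par) :
    ‖p.inputOf t r e‖ ≤ (p.α₁ + 2) * ‖Arch.err r e w‖ + (p.xdB + p.xdB') := by
  have hα := p.α₁_pos
  calc ‖p.inputOf t r e‖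
      ≤ ‖e + p.xd t‖ + ‖r - p.α₁ • e + deriv p.xd t‖ := Arch.norm_pair_le _ _
    _ ≤ (‖e‖ + ‖p.xd t‖) + (‖r‖ + p.α₁ * ‖e‖ + ‖deriv p.xd t‖) :=
        add_le_add (norm_add_le _ _) ((norm_add_le _ _).trans (by
          grw [norm_sub_le, norm_smul, Real.norm_of_nonneg hα.le]))
    _ ≤ (‖Arch.err r e w‖ + p.xdB)
          + (‖Arch.err r e w‖ + p.α₁ * ‖Arch.err r e w‖ + p.xdB') := by
        grw [Arch.norm_snd_le_norm_err r e w, Arch.norm_fst_le_norm_err r e w, p.xd_le t ht,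
          p.xd'_le t ht]
    _ = _ := by ring

theorem norm_rem_le {X : A.Inp} {θ w : A.Par} {K : Set A.Par} (hK : Convex ℝ K) {M : ℝ}
    (hM : ∀ v ∈ K, ‖p.J₂ X v‖ ≤ M) (hθ : θ ∈ K) (hw : w ∈ K) :
    ‖p.rem X θ w‖ ≤ M * ‖w - θ‖ ^ 2 :=
  norm_sub_sub_le_of_hasFDerivWithinAt hK (fun v _ => (p.hasFDerivAt_Φ X v).hasFDerivWithinAt)
    (fun v _ => (p.hasFDerivAt_J X v).hasFDerivWithinAt) hM hθ hw

theorem continuous_JT_appErr_sub_rem :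
    Continuous (fun q : A.Inp × A.Par => p.JT q.1 q.2 (p.appErr q.1 - p.rem q.1 q.2 0)) := by
  have hf : Continuous p.f := p.f_C1.continuous
  have hΦs : ∀ θ, Continuous (fun q : A.Inp × A.Par => p.Φ q.1 θ) := fun θ =>
    p.continuous_Φ.comp (f := fun q : A.Inp × A.Par => (q.1, θ)) (by fun_prop)
  have hJ : Continuous (fun q : A.Inp × A.Par => p.J q.1 q.2 (0 - q.2)) :=
    p.continuous_J.clm_apply (by fun_prop)
  exact p.continuous_JT.clm_apply
    (((hf.comp continuous_fst).sub (hΦs p.θs)).sub (((hΦs 0).sub p.continuous_Φ).sub hJ))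

theorem exists_isBounding : ∃ ρ₁ ρ₂ ρ₃ ρ₅ : ℝ → ℝ, p.IsBounding ρ₁ ρ₂ ρ₃ ρ₅ := by
  obtain ⟨ρ₁, incr₁, hJ⟩ := exists_incrNonneg_bound p.continuous_J.norm p.isCompact_Θε
  obtain ⟨ρ₂, incr₂, hJ₂⟩ := exists_incrNonneg_bound
    (Continuous.norm (E := A.Par →L[ℝ] A.Par →L[ℝ] A.Vec) p.contDiff_J₂.continuous) p.isCompact_Θε
  obtain ⟨ρ₅, incr₅, h₅⟩ :=
    exists_incrNonneg_bound p.continuous_JT_appErr_sub_rem.norm p.isCompact_Θε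
  have hm : 0 < p.α₁ + 2 := by linarith [p.α₁_pos]
  have hd : 0 ≤ p.xdB + p.xdB' := add_nonneg p.xdB_nonneg p.xdB'_nonneg
  have hrem : ∀ X (r e : A.Vec) (w : A.Par), p.θs - w ∈ p.Θε →
      ‖p.rem X (p.θs - w) p.θs‖ ≤ ρ₂ ‖X‖ * ‖Arch.err r e w‖ ^ 2 := fun X r e w hw =>
    calc ‖p.rem X (p.θs - w) p.θs‖ ≤ ρ₂ ‖X‖ * ‖p.θs - (p.θs - w)‖ ^ 2 :=
          p.norm_rem_le p.convex_Θε (hJ₂ X) hw p.θs_mem_Θε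
      _ ≤ ρ₂ ‖X‖ * ‖Arch.err r e w‖ ^ 2 := by
          rw [sub_sub_cancel]
          exact mul_le_mul_of_nonneg_left
            (pow_le_pow_left₀ (norm_nonneg w) (Arch.norm_thd_le_norm_err r e w) 2)
            (incr₂.2 _ (norm_nonneg X))
  refine ⟨ρ₁, _, _, ρ₅, incr₁, incr₂.comp_affine hm hd, (incr₁.mul incr₂).comp_affine hm hd, incr₅,
    hJ, fun t ht r e w hw => ?_, fun t ht ri ei wi r e w hw => ?_, h₅⟩
  · grw [hrem _ r e w hw, incr₂.le (norm_nonneg _) (p.norm_inputOf_le ht r e w)]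
  · generalize hX : p.inputOf t ri ei = X
    calc ‖p.JT X (p.θs - w) (p.rem X (p.θs - w) p.θs)‖
        ≤ ‖p.JT X (p.θs - w)‖ * ‖p.rem X (p.θs - w) p.θs‖ := ContinuousLinearMap.le_opNorm _ _
      _ ≤ ρ₁ ‖X‖ * (ρ₂ ‖X‖ * ‖Arch.err r e w‖ ^ 2) :=
          mul_le_mul (p.norm_JT X _ ▸ hJ X _ hw) (hrem X r e w hw) (norm_nonneg _)
            (incr₁.2 _ (norm_nonneg X))
      _ = ρ₁ ‖X‖ * ρ₂ ‖X‖ * ‖Arch.err r e w‖ ^ 2 := by ring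
      _ ≤ _ := mul_le_mul_of_nonneg_right ((incr₁.mul incr₂).le (norm_nonneg X)
          (hX ▸ p.norm_inputOf_le ht ri ei wi)) (sq_nonneg _)

/-- The derivative `d/dt f(x, ẋ)` along the closed loop as a function of the reference data
`d = (x_d, ẋ_d, ẍ_d)` and of the errors `z = (r, e, θ̃)`. Unlike the time `t`, on which
`IsFdotBound` is based, `d` ranges over a compact set. -/
noncomputable def fdot (d : A.Vec × A.Vec × A.Vec) (z : A.Vec × A.Vec × A.Par) : A.Vec :=
  let v := z.1 - p.α₁ • z.2.1 + d.2.1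
  let X := Arch.pairL (z.2.1 + d.1, v)
  fderiv ℝ p.f X (Arch.pairL (v, p.f X + (d.2.2 - p.Φ X (p.θs - z.2.2) - p.k₁ • z.1 - z.2.1
    - p.α₁ • (z.1 - p.α₁ • z.2.1))))

theorem continuous_fdot : Continuous fun q : (A.Vec × A.Vec × A.Vec) × (A.Vec × A.Vec × A.Par) =>
    p.fdot q.1 q.2 := by
  let v : (A.Vec × A.Vec × A.Vec) × (A.Vec × A.Vec × A.Par) → A.Vec := fun q =>
    q.2.1 - p.α₁ • q.2.2.1 + q.1.2.1
  let X : (A.Vec × A.Vec × A.Vec) × (A.Vec × A.Vec × A.Par) → A.Inp := fun q =>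
    Arch.pairL (q.2.2.1 + q.1.1, v q)
  have hv : Continuous v := by fun_prop
  have hX : Continuous X := Arch.pairL.continuous.comp (by fun_prop)
  have hf : Continuous fun q => p.f (X q) := p.f_C1.continuous.comp hX
  have hf' : Continuous fun q => fderiv ℝ p.f (X q) :=
    (p.f_C1.continuous_fderiv one_ne_zero).comp hX
  have hΦ : Continuous fun q => p.Φ (X q) (p.θs - q.2.2.2) :=
    p.continuous_Φ.comp (f := fun q => (X q, p.θs - q.2.2.2)) (by fun_prop)
  exact hf'.clm_apply (Arch.pairL.continuous.comp (by fun_prop))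

theorem exists_isFdotBound (χ : ℝ) : ∃ δf : ℝ, 0 < δf ∧ p.IsFdotBound χ δf := by
  obtain ⟨C, hC⟩ := ((isCompact_closedBall (0 : A.Vec × A.Vec × A.Vec)
    (max p.xdB (max p.xdB' p.xdB''))).prod (isCompact_closedBall (0 : A.Vec × A.Vec × A.Par)
    χ)).exists_bound_of_continuousOn p.continuous_fdot.continuousOn
  refine ⟨max C 1, by positivity, fun t ht r e w (hz : ‖Arch.err r e w‖ ≤ χ) => ?_⟩
  refine le_max_of_le_left (hC ((p.xd t, deriv p.xd t, deriv (deriv p.xd) t), (r, e, w)) ⟨?_, ?_⟩)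
  · exact mem_closedBall_zero_iff.2
      (max_le_max (p.xd_le t ht) (max_le_max (p.xd'_le t ht) (p.xd''_le t ht)))
  · exact mem_closedBall_zero_iff.2 (max_le ((Arch.norm_fst_le_norm_err r e w).trans hz)
      (max_le ((Arch.norm_snd_le_norm_err r e w).trans hz)
        ((Arch.norm_thd_le_norm_err r e w).trans hz)))

end Problem

/-! ### Solutions of the closed loop -/

theorem isSymmetric_inv {W : Type*} [NormedAddCommGroup W] [InnerProductSpace ℝ W]
    {G Gi : W →L[ℝ] W} (hG : G.IsSymmetric) (hinv : ∀ w, G (Gi w) = w) : Gi.IsSymmetric :=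
  fun x y =>
    calc inner ℝ (Gi x) y = inner ℝ (Gi x) (G (Gi y)) := by rw [hinv]
      _ = inner ℝ (G (Gi x)) (Gi y) := (hG _ _).symm
      _ = inner ℝ x (Gi y) := by rw [hinv]

namespace Problem

variable {A : Arch} (p : Problem A)

theorem lΓmax_pos : 0 < p.lΓmax := p.lΓmin_pos.trans_le p.lΓ_le

theorem Λ₁_pos : 0 < p.Λ₁ := lt_min p.kΔ_pos (mul_pos two_pos p.α₂_pos)

/-- The inverses of the admissible gains, as a closed condition: a symmetric `G` has its eigenvalues
in `[λ_{Γ,min}, λ_{Γ,max}]` if and only if `G⁻¹` satisfies these bounds. -/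
def gainInverses : Set (A.Par →L[ℝ] A.Par) :=
  {M | ∀ w, 1 / p.lΓmax * ‖w‖ ^ 2 ≤ inner ℝ (M w) w ∧ inner ℝ (M w) w ≤ 1 / p.lΓmin * ‖w‖ ^ 2}

theorem isClosed_gainInverses : IsClosed p.gainInverses := by
  have hcont : ∀ w : A.Par, Continuous fun M : A.Par →L[ℝ] A.Par => inner ℝ (M w) w := fun w => by
    fun_prop
  have heq : p.gainInverses = ⋂ w : A.Par,
      {M | 1 / p.lΓmax * ‖w‖ ^ 2 ≤ inner ℝ (M w) w} ∩
        {M | inner ℝ (M w) w ≤ 1 / p.lΓmin * ‖w‖ ^ 2} := by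
    ext M
    simp [gainInverses]
  exact heq ▸ isClosed_iInter fun w =>
    (isClosed_le continuous_const (hcont w)).inter (isClosed_le (hcont w) continuous_const)

theorem inv_mem_gainInverses {G Gi : A.Par →L[ℝ] A.Par} (hG : G.IsSymmetric)
    (hinv : ∀ w, G (Gi w) = w) (hmin : p.lΓmin ≤ lamMin G) (hmax : lamMax G ≤ p.lΓmax) :
    Gi ∈ p.gainInverses := by
  have hle : ∀ w, p.lΓmin * ‖w‖ ^ 2 ≤ inner ℝ (G w) w := fun w =>
    (mul_le_mul_of_nonneg_right hmin (sq_nonneg _)).trans (lamMin_mul_le_inner hG w)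
  have hge : ∀ w, inner ℝ (G w) w ≤ p.lΓmax * ‖w‖ ^ 2 := fun w =>
    (inner_le_lamMax_mul hG w).trans (mul_le_mul_of_nonneg_right hmax (sq_nonneg _))
  have hnonneg : ∀ w, 0 ≤ inner ℝ (G w) w := fun w =>
    (mul_nonneg p.lΓmin_pos.le (sq_nonneg _)).trans (hle w)
  exact fun w => ⟨le_inner_inv p.lΓmax_pos hG hinv hnonneg hge w,
    inner_inv_le p.lΓmin_pos hinv hle w⟩

theorem hasDerivAt_xd (t : ℝ) : HasDerivAt p.xd (deriv p.xd t) t :=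
  (p.xd_C2.differentiable two_ne_zero t).hasDerivAt

theorem contDiff_deriv_xd : ContDiff ℝ 1 (deriv p.xd) := p.xd_C2.deriv'

theorem hasDerivAt_deriv_xd (t : ℝ) : HasDerivAt (deriv p.xd) (deriv (deriv p.xd) t) t :=
  (p.contDiff_deriv_xd.differentiable one_ne_zero t).hasDerivAt

end Problem

namespace Signals

variable {A : Arch} {N : ℕ} (s : Signals A N) (p : Problem A)

theorem inner_gram (t : ℝ) (x y : A.Par) : inner ℝ (s.gram p t x) y =
    ∑ i ∈ s.stack t, inner ℝ (p.J (s.X (s.ts i)) (s.θh t) x) (p.J (s.X (s.ts i)) (s.θh t) y) := by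
  simp [gram, Problem.JT, sum_inner, ContinuousLinearMap.adjoint_inner_left]

theorem isSymmetric_gram (t : ℝ) : (s.gram p t).IsSymmetric := fun x y => by
  simp only [ContinuousLinearMap.coe_coe]
  rw [real_inner_comm (s.gram p t y) x, inner_gram, inner_gram]
  exact Finset.sum_congr rfl fun i _ => real_inner_comm _ _

theorem r_sub_smul_e (t : ℝ) : s.r p t - p.α₁ • s.e p t = s.edot p t := add_sub_cancel_right _ _

theorem X_eq_inputOf (t : ℝ) : s.X t = p.inputOf t (s.r p t) (s.e p t) := by
  rw [Problem.inputOf, r_sub_smul_e]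
  simp [X, e, edot]

theorem u_eq_ctrl (t : ℝ) : s.u p t = p.ctrl t (s.r p t) (s.e p t) (s.θh t) := by
  rw [u, Problem.ctrl, r_sub_smul_e, ← X_eq_inputOf]

theorem norm_sq_ζ (t : ℝ) : ‖s.ζ p t‖ ^ 2 = ‖s.r p t‖ ^ 2 + ‖s.e p t‖ ^ 2 + ‖s.θt p t‖ ^ 2 :=
  Arch.norm_sq_err _ _ _

theorem norm_sq_z (t : ℝ) : ‖s.z p t‖ ^ 2 = ‖s.rt p t‖ ^ 2 + ‖s.Δt p t‖ ^ 2 := by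
  rw [z, WithLp.prod_norm_sq_eq_of_L2]
  rfl

theorem norm_rt_le_norm_z (t : ℝ) : ‖s.rt p t‖ ≤ ‖s.z p t‖ := WithLp.norm_fst_le _ (s.z p t)

theorem norm_Δt_le_norm_z (t : ℝ) : ‖s.Δt p t‖ ≤ ‖s.z p t‖ := WithLp.norm_snd_le _ (s.z p t)

end Signals

namespace IsClosedLoop

variable {A : Arch} {N : ℕ} {p : Problem A} {s : Signals A N} {b : EReal} {δf : ℝ} {t : ℝ}

theorem t₀_mem (h : IsClosedLoop p s b δf) : p.t₀ ∈ span p.t₀ b := ⟨le_rfl, h.nonempty⟩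

section Gain

theorem Γ_Γinv (h : IsClosedLoop p s b δf) (ht : t ∈ span p.t₀ b) (w : A.Par) :
    s.Γ t (s.Γinv t w) = w :=
  DFunLike.congr_fun (h.Γ_inv t ht).1 w

theorem Γinv_Γ (h : IsClosedLoop p s b δf) (ht : t ∈ span p.t₀ b) (w : A.Par) :
    s.Γinv t (s.Γ t w) = w :=
  DFunLike.congr_fun (h.Γ_inv t ht).2 w

/-- The skew part of `Γ⁻¹` vanishes at `t₀` and solves `ẏ = -c(t) y` with `c ≥ 0`, so that its
square cannot grow. -/
theorem isSymmetric_Γinv (h : IsClosedLoop p s b δf) (ht : t ∈ span p.t₀ b) :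
    (s.Γinv t).IsSymmetric := fun x y => by
  let skew : (A.Par →L[ℝ] A.Par) →L[ℝ] ℝ :=
    (innerSL ℝ y).comp (.apply ℝ A.Par x) - (innerSL ℝ x).comp (.apply ℝ A.Par y)
  have hskew : ∀ M, skew M = inner ℝ (M x) y - inner ℝ x (M y) := fun M => by
    simp [skew, real_inner_comm]
  have hskew_symm : ∀ M : A.Par →L[ℝ] A.Par, M.IsSymmetric → skew M = 0 := fun M hM => by
    rw [hskew, sub_eq_zero]
    exact hM x y
  have hinit : skew (s.Γinv p.t₀) = 0 := hskew_symm _ <| isSymmetric_inv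
    (ContinuousLinearMap.isSelfAdjoint_iff_isSymmetric.1 h.Γ_init.1) (h.Γ_Γinv h.t₀_mem)
  have hdecay : ∀ τ, skew (s.Γinv τ) * skew (s.Γrhs p τ) ≤ 0 := fun τ => by
    unfold Signals.Γrhs
    split_ifs
    · rw [map_add, map_neg, map_smul, map_smul, hskew_symm _ (s.isSymmetric_gram p τ), smul_zero,
        add_zero, smul_eq_mul]
      nlinarith [mul_nonneg (p.β_nonneg τ) (mul_self_nonneg (skew (s.Γinv τ)))]
    · simp
  have hac := (h.Γ_law.hasACDeriv ht).clm_comp skew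
  have hsq : skew (s.Γinv t) * skew (s.Γinv t) ≤ 0 := by
    have hle := (hac.mul hac).le_of_nonpos ht.1 fun τ _ => by linarith [hdecay τ]
    rwa [hinit, mul_zero] at hle
  exact sub_eq_zero.1 ((hskew _).symm.trans
    (mul_self_eq_zero.1 (hsq.antisymm (mul_self_nonneg _))))

theorem isSymmetric_Γ (h : IsClosedLoop p s b δf) (ht : t ∈ span p.t₀ b) : (s.Γ t).IsSymmetric :=
  isSymmetric_inv (h.isSymmetric_Γinv ht) (h.Γinv_Γ ht)

theorem Γinv_mem (h : IsClosedLoop p s b δf) (ht : t ∈ span p.t₀ b) :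
    s.Γinv t ∈ p.gainInverses := by
  by_contra hcon
  have hac := h.Γ_law.hasACDeriv ht
  have hcont : ContinuousOn s.Γinv (Icc p.t₀ t) := h.Γ_law.continuousOn.mono (Icc_subset_span ht)
  have hinit : s.Γinv p.t₀ ∈ p.gainInverses := p.inv_mem_gainInverses
    (h.isSymmetric_Γ h.t₀_mem) (h.Γ_Γinv h.t₀_mem) h.Γ_init.2.1 h.Γ_init.2.2
  obtain ⟨c, ⟨h0c, hct⟩, hc, hlast⟩ := exists_last_mem
    (hcont.preimage_isClosed_of_isClosed isClosed_Icc p.isClosed_gainInverses) ht.1 hinit hcon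
  have hfrozen : ∀ τ ∈ Ioo c t, s.Γrhs p τ = 0 := fun τ hτ => by
    have hτb := span_of_le ht (h0c.trans hτ.1.le) hτ.2.le
    exact if_neg fun hlam => hlast τ ⟨hτ.1, hτ.2.le⟩
      (p.inv_mem_gainInverses (h.isSymmetric_Γ hτb) (h.Γ_Γinv hτb) hlam.1.le hlam.2.le)
  have hsub : uIcc c t ⊆ uIcc p.t₀ t := by
    rw [uIcc_of_le hct.le, uIcc_of_le ht.1]
    exact Icc_subset_Icc_left h0c
  exact hcon ((hac.mono hsub).eq_of_forall_eq_zero hct.le hfrozen ▸ hc)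

theorem inner_Γ_pos (h : IsClosedLoop p s b δf) (ht : t ∈ span p.t₀ b) {w : A.Par} (hw : w ≠ 0) :
    0 < inner ℝ w (s.Γ t w) :=
  inner_apply_pos_of_le_inner_inv p.lΓmax_pos (h.Γinv_Γ ht) (fun w => (h.Γinv_mem ht w).1) hw

theorem norm_Γ_le (h : IsClosedLoop p s b δf) (ht : t ∈ span p.t₀ b) : ‖s.Γ t‖ ≤ p.lΓmax :=
  opNorm_le_of_le_inner_inv p.lΓmax_pos (h.Γinv_Γ ht) fun w => (h.Γinv_mem ht w).1

theorem norm_Γinv_le (h : IsClosedLoop p s b δf) (ht : t ∈ span p.t₀ b) :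
    ‖s.Γinv t‖ ≤ 1 / p.lΓmin := by
  have hnonneg : ∀ w, 0 ≤ inner ℝ (s.Γinv t w) w := fun w =>
    (mul_nonneg (one_div_nonneg.2 p.lΓmax_pos.le) (sq_nonneg _)).trans (h.Γinv_mem ht w).1
  exact opNorm_le_of_inner_le (one_div_pos.2 p.lΓmin_pos) (h.isSymmetric_Γinv ht) hnonneg
    fun w => (h.Γinv_mem ht w).2

theorem θh_mem (h : IsClosedLoop p s b δf) (ht : t ∈ span p.t₀ b) : s.θh t ∈ p.Θε := by
  by_contra hcon
  have hac := h.θ_law.hasACDeriv ht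
  have hcont : ContinuousOn s.θh (Icc p.t₀ t) := h.θ_law.continuousOn.mono (Icc_subset_span ht)
  obtain ⟨c, ⟨h0c, hct⟩, hc, hlast⟩ := exists_last_mem
    (hcont.preimage_isClosed_of_isClosed isClosed_Icc p.isCompact_Θε.isClosed) ht.1 h.θ_init hcon
  have hsub : uIcc c t ⊆ uIcc p.t₀ t := by
    rw [uIcc_of_le hct.le, uIcc_of_le ht.1]
    exact Icc_subset_Icc_left h0c
  have hinward : ∀ τ ∈ Ioo c t, fderiv ℝ p.P (s.θh τ) (s.θrhs p τ) ≤ 0 := fun τ hτ => by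
    have hout : p.εP ≤ p.P (s.θh τ) := (not_le.1 (hlast τ ⟨hτ.1, hτ.2.le⟩)).le
    simpa [gradient, Signals.θrhs] using inner_gradient_proj_nonpos p.εP_pos
      (h.inner_Γ_pos (span_of_le ht (h0c.trans hτ.1.le) hτ.2.le)) hout (s.rawLaw p τ)
  exact hcon ((((hac.mono hsub).comp p.P_C1).le_of_nonpos hct.le hinward).trans hc)

end Gain

section Plant

theorem hasDerivWithinAt_e (h : IsClosedLoop p s b δf) (ht : t ∈ span p.t₀ b) :
    HasDerivWithinAt (s.e p) (s.edot p t) (span p.t₀ b) t :=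
  (h.pos t ht).sub (p.hasDerivAt_xd t).hasDerivWithinAt

theorem hasDerivWithinAt_r (h : IsClosedLoop p s b δf) (ht : t ∈ span p.t₀ b) :
    HasDerivWithinAt (s.r p) (s.acc p t - deriv (deriv p.xd) t + p.α₁ • s.edot p t)
      (span p.t₀ b) t :=
  ((h.vel t ht).sub (p.hasDerivAt_deriv_xd t).hasDerivWithinAt).add
    ((h.hasDerivWithinAt_e ht).const_smul p.α₁)

theorem hasDerivWithinAt_X (h : IsClosedLoop p s b δf) (ht : t ∈ span p.t₀ b) :
    HasDerivWithinAt s.X (Arch.pair (s.v t) (s.acc p t)) (span p.t₀ b) t :=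
  Arch.pairL.hasFDerivAt.comp_hasDerivWithinAt t ((h.pos t ht).prodMk (h.vel t ht))

theorem continuousOn_edot (h : IsClosedLoop p s b δf) : ContinuousOn (s.edot p) (span p.t₀ b) :=
  .sub (fun t ht => (h.vel t ht).continuousWithinAt) p.contDiff_deriv_xd.continuous.continuousOn

theorem continuousOn_rdot (h : IsClosedLoop p s b δf) : ContinuousOn
    (fun t => s.acc p t - deriv (deriv p.xd) t + p.α₁ • s.edot p t) (span p.t₀ b) := by
  have hX : ContinuousOn s.X (span p.t₀ b) := fun t ht =>
    (h.hasDerivWithinAt_X ht).continuousWithinAt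
  have hr : ContinuousOn (s.r p) (span p.t₀ b) := fun t ht =>
    (h.hasDerivWithinAt_r ht).continuousWithinAt
  have he : ContinuousOn (s.e p) (span p.t₀ b) := fun t ht =>
    (h.hasDerivWithinAt_e ht).continuousWithinAt
  have hf : ContinuousOn (fun t => p.f (s.X t)) (span p.t₀ b) :=
    p.f_C1.continuous.comp_continuousOn hX
  have hΦ : ContinuousOn (fun t => p.Φ (s.X t) (s.θh t)) (span p.t₀ b) :=
    p.continuous_Φ.comp_continuousOn (hX.prodMk h.θ_law.continuousOn)
  have hxd : ContinuousOn (deriv (deriv p.xd)) (span p.t₀ b) :=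
    (p.contDiff_deriv_xd.continuous_deriv le_rfl).continuousOn
  have hedot := h.continuousOn_edot
  unfold Signals.acc Signals.u
  fun_prop

theorem hasACDeriv_e (h : IsClosedLoop p s b δf) (ht : t ∈ span p.t₀ b) :
    HasACDeriv (s.e p) (s.edot p) p.t₀ t :=
  .of_hasDerivWithinAt ht.1
    (fun _ hτ => (h.hasDerivWithinAt_e (Icc_subset_span ht hτ)).mono (Icc_subset_span ht))
    (h.continuousOn_edot.mono (Icc_subset_span ht))

theorem hasACDeriv_r (h : IsClosedLoop p s b δf) (ht : t ∈ span p.t₀ b) :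
    HasACDeriv (s.r p) (fun τ => s.acc p τ - deriv (deriv p.xd) τ + p.α₁ • s.edot p τ) p.t₀ t :=
  .of_hasDerivWithinAt ht.1
    (fun _ hτ => (h.hasDerivWithinAt_r (Icc_subset_span ht hτ)).mono (Icc_subset_span ht))
    (h.continuousOn_rdot.mono (Icc_subset_span ht))

theorem continuousOn_ζ (h : IsClosedLoop p s b δf) : ContinuousOn (s.ζ p) (span p.t₀ b) := by
  have hr : ContinuousOn (s.r p) (span p.t₀ b) := fun t ht =>
    (h.hasDerivWithinAt_r ht).continuousWithinAt
  have he : ContinuousOn (s.e p) (span p.t₀ b) := fun t ht =>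
    (h.hasDerivWithinAt_e ht).continuousWithinAt
  have hθ : ContinuousOn (s.θt p) (span p.t₀ b) := continuousOn_const.sub h.θ_law.continuousOn
  exact (WithLp.prod_continuous_toLp _ _ _).comp_continuousOn
    (hr.prodMk ((WithLp.prod_continuous_toLp _ _ _).comp_continuousOn (he.prodMk hθ)))

end Plant

end IsClosedLoop

/-! ### The observer -/

theorem two_mul_inner_le_mul_sq_add_div {V : Type*} [NormedAddCommGroup V] [InnerProductSpace ℝ V]
    {c δ : ℝ} (hc : 0 < c) {x y : V} (hy : ‖y‖ ≤ δ) :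
    2 * inner ℝ x y ≤ c * ‖x‖ ^ 2 + δ ^ 2 / c := by
  have hcs : inner ℝ x y ≤ ‖x‖ * δ :=
    (real_inner_le_norm x y).trans (mul_le_mul_of_nonneg_left hy (norm_nonneg x))
  have hsq : (c * ‖x‖ - δ) ^ 2 / c = c * ‖x‖ ^ 2 + δ ^ 2 / c - 2 * (‖x‖ * δ) := by
    field_simp
    ring
  linarith [div_nonneg (sq_nonneg (c * ‖x‖ - δ)) hc.le]

/-- The cross terms `⟪r, d⟫` of the two observer equations cancel. -/
theorem observer_dissipation {V : Type*} [NormedAddCommGroup V] [InnerProductSpace ℝ V]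
    {α κ δ : ℝ} (hκ : 0 < κ) (r d : V) {F : V} (hF : ‖F‖ ≤ δ) :
    2 * inner ℝ r (d - α • r) + 2 * inner ℝ d (F - (r + κ • d)) ≤
      -min κ (2 * α) * (‖r‖ ^ 2 + ‖d‖ ^ 2) + δ ^ 2 / κ := by
  have hyoung := two_mul_inner_le_mul_sq_add_div (x := d) hκ hF
  have hr : min κ (2 * α) * ‖r‖ ^ 2 ≤ 2 * α * ‖r‖ ^ 2 :=
    mul_le_mul_of_nonneg_right (min_le_right _ _) (sq_nonneg _)
  have hd : min κ (2 * α) * ‖d‖ ^ 2 ≤ κ * ‖d‖ ^ 2 :=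
    mul_le_mul_of_nonneg_right (min_le_left _ _) (sq_nonneg _)
  simp only [inner_sub_right, inner_add_right, real_inner_smul_right, real_inner_self_eq_norm_sq,
    real_inner_comm r d]
  linarith

theorem mul_exp_neg_add_le_of_log_le {Λ a q d T : ℝ} (hΛ : 0 < Λ) (hq : q < d) (ha : d < a)
    (hT : 1 / Λ * Real.log ((a - q) / (d - q)) ≤ T) :
    a * Real.exp (-Λ * T) + q * (1 - Real.exp (-Λ * T)) ≤ d := by
  have hlog : Real.log ((a - q) / (d - q)) ≤ Λ * T := by
    rwa [one_div, inv_mul_le_iff₀ hΛ] at hT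
  have hratio : (a - q) / (d - q) ≤ Real.exp (Λ * T) :=
    (Real.log_le_iff_le_exp (div_pos (by linarith) (by linarith))).1 hlog
  have hdecay : (a - q) * Real.exp (-Λ * T) ≤ d - q := by
    rwa [neg_mul, Real.exp_neg, ← div_eq_mul_inv, div_le_iff₀ (Real.exp_pos _), mul_comm,
      ← div_le_iff₀ (sub_pos.2 hq)]
  linarith

theorem exp_neg_mul_le_one {Λ T : ℝ} (hΛ : 0 ≤ Λ) (hT : 0 ≤ T) : Real.exp (-Λ * T) ≤ 1 :=
  Real.exp_le_one_iff.2 (by rw [neg_mul, neg_nonpos]; exact mul_nonneg hΛ hT)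

namespace IsClosedLoop

variable {A : Arch} {N : ℕ} {p : Problem A} {s : Signals A N} {b : EReal} {δf t : ℝ}

theorem hasDerivWithinAt_rt (h : IsClosedLoop p s b δf) (ht : t ∈ span p.t₀ b) :
    HasDerivWithinAt (s.rt p) (s.Δt p t - p.α₂ • s.rt p t) (span p.t₀ b) t :=
  ((h.hasDerivWithinAt_r ht).sub (h.obs_r t ht)).congr_deriv (by
    simp only [Signals.Δt]
    abel)

theorem hasDerivWithinAt_Δt (h : IsClosedLoop p s b δf) (ht : t ∈ span p.t₀ b) :
    HasDerivWithinAt (s.Δt p) (fderiv ℝ p.f (s.X t) (Arch.pair (s.v t) (s.acc p t)) -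
      (s.rt p t + p.kΔ • s.Δt p t)) (span p.t₀ b) t := by
  have hf : HasDerivWithinAt (fun τ => p.f (s.X τ))
      (fderiv ℝ p.f (s.X t) (Arch.pair (s.v t) (s.acc p t))) (span p.t₀ b) t :=
    (p.f_C1.differentiable one_ne_zero _).hasFDerivAt.comp_hasDerivWithinAt t
      (h.hasDerivWithinAt_X ht)
  refine (hf.sub (h.obs_Δ t ht)).congr_of_mem (fun τ _ => ?_) ht
  simp only [Signals.Δt, Signals.acc, Pi.sub_apply]
  abel

end IsClosedLoop

theorem Signals.norm_fderiv_f_le {A : Arch} {N : ℕ} (s : Signals A N) {p : Problem A}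
    {δf χ t : ℝ} (hf : p.IsFdotBound χ δf) (ht : p.t₀ ≤ t) (hD : s.ζ p t ∈ p.D χ) :
    ‖fderiv ℝ p.f (s.X t) (Arch.pair (s.v t) (s.acc p t))‖ ≤ δf := by
  have hv : s.r p t - p.α₁ • s.e p t + deriv p.xd t = s.v t := by
    rw [r_sub_smul_e, edot, sub_add_cancel]
  have hθ : p.θs - s.θt p t = s.θh t := sub_sub_cancel _ _
  have hbound := hf t ht (s.r p t) (s.e p t) (s.θt p t) hD
  rwa [hv, hθ, ← s.u_eq_ctrl, ← s.X_eq_inputOf] at hbound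

namespace IsClosedLoop

variable {A : Arch} {N : ℕ} {p : Problem A} {s : Signals A N} {b : EReal} {δf χ t : ℝ}

theorem norm_sq_z_le (h : IsClosedLoop p s b δf) (hf : p.IsFdotBound χ δf)
    (ht : t ∈ span p.t₀ b) (hD : ∀ τ ∈ Icc p.t₀ t, s.ζ p τ ∈ p.D χ) :
    ‖s.z p t‖ ^ 2 ≤ ‖s.z p p.t₀‖ ^ 2 * Real.exp (-p.Λ₁ * (t - p.t₀)) +
      δf ^ 2 / p.kΔ / p.Λ₁ * (1 - Real.exp (-p.Λ₁ * (t - p.t₀))) := by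
  simp only [s.norm_sq_z]
  refine le_exp_of_hasDerivWithinAt_le (v := fun τ => ‖s.rt p τ‖ ^ 2 + ‖s.Δt p τ‖ ^ 2) ht.1
    p.Λ₁_pos (fun τ hτ => ?_)
    fun τ hτ => observer_dissipation p.kΔ_pos _ _ (s.norm_fderiv_f_le hf hτ.1 (hD τ hτ))
  have hτb := Icc_subset_span ht hτ
  exact ((h.hasDerivWithinAt_rt hτb).norm_sq.add (h.hasDerivWithinAt_Δt hτb).norm_sq).mono
    (Icc_subset_span ht)

theorem norm_sq_z_le_const (h : IsClosedLoop p s b δf) (hf : p.IsFdotBound χ δf)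
    (ht : t ∈ span p.t₀ b) (hD : ∀ τ ∈ Icc p.t₀ t, s.ζ p τ ∈ p.D χ) :
    ‖s.z p t‖ ^ 2 ≤ ‖s.z p p.t₀‖ ^ 2 + δf ^ 2 / p.kΔ / p.Λ₁ := by
  have hexp := exp_neg_mul_le_one p.Λ₁_pos.le (sub_nonneg.2 ht.1)
  have hq : 0 ≤ δf ^ 2 / p.kΔ / p.Λ₁ :=
    div_nonneg (div_nonneg (sq_nonneg _) p.kΔ_pos.le) p.Λ₁_pos.le
  refine (h.norm_sq_z_le hf ht hD).trans (add_le_add ?_ ?_)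
  · exact mul_le_of_le_one_right (sq_nonneg _) hexp
  · exact mul_le_of_le_one_right hq (by linarith [Real.exp_pos (-p.Λ₁ * (t - p.t₀))])

theorem norm_Δt_le (h : IsClosedLoop p s b δf) (hf : p.IsFdotBound χ δf)
    (hgain : δf ^ 2 / p.δΔ ^ 2 < p.kΔ * p.Λ₁) (ht : t ∈ span p.t₀ b)
    (hD : ∀ τ ∈ Icc p.t₀ t, s.ζ p τ ∈ p.D χ) (hset : s.tΔ p δf ≤ t) : ‖s.Δt p t‖ ≤ p.δΔ := by
  have hκΛ : 0 < p.kΔ * p.Λ₁ := mul_pos p.kΔ_pos p.Λ₁_pos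
  have hq : δf ^ 2 / p.kΔ / p.Λ₁ < p.δΔ ^ 2 := by
    rwa [div_div, div_lt_iff₀ hκΛ, mul_comm, ← div_lt_iff₀ (pow_pos p.δΔ_pos 2)]
  have hfactor : ∀ c : ℝ, p.kΔ * p.Λ₁ * c - δf ^ 2 =
      p.kΔ * p.Λ₁ * (c - δf ^ 2 / p.kΔ / p.Λ₁) := fun c => by
    rw [mul_sub, div_div, mul_div_cancel₀ _ hκΛ.ne']
  have hz : ‖s.z p t‖ ^ 2 ≤ p.δΔ ^ 2 := by
    refine (h.norm_sq_z_le hf ht hD).trans ?_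
    unfold Signals.tΔ at hset
    split_ifs at hset with hinit
    · have hexp := exp_neg_mul_le_one p.Λ₁_pos.le (sub_nonneg.2 ht.1)
      have hinit_sq := pow_le_pow_left₀ (norm_nonneg _) hinit 2
      nlinarith [Real.exp_pos (-p.Λ₁ * (t - p.t₀))]
    · have hinit_sq := pow_lt_pow_left₀ (not_le.1 hinit) p.δΔ_pos.le two_ne_zero
      rw [hfactor, hfactor, mul_div_mul_left _ _ hκΛ.ne'] at hset
      exact mul_exp_neg_add_le_of_log_le p.Λ₁_pos hq hinit_sq (by linarith)
  exact (s.norm_Δt_le_norm_z p t).trans (le_of_sq_le_sq hz p.δΔ_pos.le)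

end IsClosedLoop

/-! ### The Lyapunov function -/

theorem inner_le_half_sq_add_half_sq {V : Type*} [NormedAddCommGroup V] [InnerProductSpace ℝ V]
    {δ : ℝ} {x y : V} (hy : ‖y‖ ≤ δ) : inner ℝ x y ≤ 1 / 2 * ‖x‖ ^ 2 + 1 / 2 * δ ^ 2 := by
  have hyoung := two_mul_inner_le_mul_sq_add_div (x := x) one_pos hy
  rw [div_one] at hyoung
  linarith

namespace Problem

variable {A : Arch} (p : Problem A)

theorem β₁_pos : 0 < p.β₁ :=
  lt_min one_half_pos (mul_pos one_half_pos (one_div_pos.2 p.lΓmax_pos))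

theorem β₁_le_β₂ : p.β₁ ≤ p.β₂ := (min_le_left _ _).trans (le_max_left _ _)

theorem β₂_pos : 0 < p.β₂ := p.β₁_pos.trans_le p.β₁_le_β₂

end Problem

namespace Signals

variable {A : Arch} {N : ℕ} (s : Signals A N) (p : Problem A)

/-- The Lyapunov function `½ ‖r‖² + ½ ‖e‖² + ½ θ̃ᵀ Γ⁻¹ θ̃` of the closed loop. -/
noncomputable def lyap (t : ℝ) : ℝ :=
  1 / 2 * inner ℝ (s.r p t) (s.r p t) + 1 / 2 * inner ℝ (s.e p t) (s.e p t) +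
    1 / 2 * inner ℝ (s.θt p t) (s.Γinv t (s.θt p t))

/-- The almost everywhere derivative `rᵀ ṙ + eᵀ ė + ½ θ̃ᵀ (d/dt Γ⁻¹) θ̃ - θ̃ᵀ Γ⁻¹ (d/dt θ̂)` of
`lyap` along the closed loop, with `ṙ = ẍ - ẍ_d + α₁ ė`. -/
noncomputable def lyapDeriv (t : ℝ) : ℝ :=
  inner ℝ (s.r p t) (s.acc p t - deriv (deriv p.xd) t + p.α₁ • s.edot p t) +
    inner ℝ (s.e p t) (s.edot p t) + 1 / 2 * inner ℝ (s.Γrhs p t (s.θt p t)) (s.θt p t) -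
    inner ℝ (s.θt p t) (s.Γinv t (s.θrhs p t))

theorem ι₄_nonneg (ρ₁ ρ₅ : ℝ → ℝ) (εB : ℝ) : 0 ≤ s.ι₄ p ρ₁ ρ₅ εB := by
  have hγ₁ := p.γ₁_pos
  have hγ₂ := p.γ₂_pos
  have hδ := p.δΔ_pos
  unfold ι₄
  positivity

theorem θs_sub_θt (t : ℝ) : p.θs - s.θt p t = s.θh t := sub_sub_cancel _ _

theorem X_mem_Ω {t χ : ℝ} (ht : p.t₀ ≤ t) (hζ : s.ζ p t ∈ p.D χ) : s.X t ∈ p.Ω χ := by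
  have hX := p.norm_inputOf_le ht (s.r p t) (s.e p t) (s.θt p t)
  rw [← X_eq_inputOf, ← add_assoc] at hX
  have hα : 0 ≤ p.α₁ + 2 := add_nonneg p.α₁_pos.le zero_le_two
  exact hX.trans (by gcongr; exact hζ)

theorem rdot_eq (t : ℝ) :
    s.acc p t - deriv (deriv p.xd) t + p.α₁ • s.edot p t =
      p.appErr (s.X t) + p.rem (s.X t) (s.θh t) p.θs + p.J (s.X t) (s.θh t) (s.θt p t) -
        p.k₁ • s.r p t - s.e p t := by
  simp only [acc, u, Problem.appErr, Problem.rem, θt]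
  abel

/-- The recorded data are affine in the parameter error, up to the observer error, the
approximation error and two Taylor remainders; this uses `Φ(X, 0) = 0`. -/
theorem data_eq (t τ : ℝ) :
    s.u p τ - s.Δh τ + p.J (s.X τ) (s.θh t) (s.θh t) =
      s.Δt p τ - (p.appErr (s.X τ) - p.rem (s.X τ) (s.θh t) 0) -
        p.J (s.X τ) (s.θh t) (s.θt p t) - p.rem (s.X τ) (s.θh t) p.θs := by
  simp only [Δt, acc, Problem.appErr, Problem.rem, θt, p.Φ_zero, map_sub, map_zero]
  abel

variable {s p} {ρ₁ ρ₂ ρ₃ ρ₅ : ℝ → ℝ} {t : ℝ}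

theorem norm_rem_le (hb : p.IsBounding ρ₁ ρ₂ ρ₃ ρ₅) (ht : p.t₀ ≤ t) (hθ : s.θh t ∈ p.Θε) :
    ‖p.rem (s.X t) (s.θh t) p.θs‖ ≤ ρ₂ ‖s.ζ p t‖ * ‖s.ζ p t‖ ^ 2 := by
  have hcur := hb.cur t ht (s.r p t) (s.e p t) (s.θt p t)
  rw [θs_sub_θt, ← X_eq_inputOf] at hcur
  exact hcur hθ

theorem norm_JT_rem_le (hb : p.IsBounding ρ₁ ρ₂ ρ₃ ρ₅) {τ : ℝ} (hτ : p.t₀ ≤ τ)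
    (hθ : s.θh t ∈ p.Θε) :
    ‖p.JT (s.X τ) (s.θh t) (p.rem (s.X τ) (s.θh t) p.θs)‖ ≤ ρ₃ ‖s.ζ p τ‖ * ‖s.ζ p t‖ ^ 2 := by
  have hhist := hb.hist τ hτ (s.r p τ) (s.e p τ) (s.θt p τ) (s.r p t) (s.e p t) (s.θt p t)
  rw [θs_sub_θt, ← X_eq_inputOf] at hhist
  exact hhist hθ

theorem inner_JT_data_le (hb : p.IsBounding ρ₁ ρ₂ ρ₃ ρ₅) {τ : ℝ} (hτ : p.t₀ ≤ τ)
    (hθ : s.θh t ∈ p.Θε) (hΔ : ‖s.Δt p τ‖ ≤ p.δΔ) :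
    inner ℝ (s.θt p t) (p.JT (s.X τ) (s.θh t)
      (s.u p τ - s.Δh τ + p.J (s.X τ) (s.θh t) (s.θh t))) ≤
    -inner ℝ (p.J (s.X τ) (s.θh t) (s.θt p t)) (p.J (s.X τ) (s.θh t) (s.θt p t)) +
      (p.δΔ / 2 + 1) * ‖s.θt p t‖ ^ 2 + p.δΔ / 2 * ρ₁ ‖s.X τ‖ ^ 2 +
      1 / 2 * ρ₅ ‖s.X τ‖ ^ 2 + 1 / 2 * (ρ₃ ‖s.ζ p τ‖ ^ 2 * ‖s.ζ p t‖ ^ 2 * ‖s.ζ p t‖ ^ 2) := by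
  have hobs_norm : ‖p.JT (s.X τ) (s.θh t) (s.Δt p τ)‖ ≤ ρ₁ ‖s.X τ‖ * p.δΔ :=
    (p.JT (s.X τ) (s.θh t)).le_of_opNorm_le_of_le
      ((p.norm_JT _ _).trans_le (hb.jac _ _ hθ)) hΔ
  have hobs := two_mul_inner_le_mul_sq_add_div (x := s.θt p t) p.δΔ_pos hobs_norm
  have happ := inner_le_half_sq_add_half_sq (x := s.θt p t)
    ((norm_neg _).trans_le (hb.zero (s.X τ) _ hθ))
  have hrem := inner_le_half_sq_add_half_sq (x := s.θt p t)
    ((norm_neg _).trans_le (norm_JT_rem_le hb hτ hθ))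
  have hdiv : (ρ₁ ‖s.X τ‖ * p.δΔ) ^ 2 / p.δΔ = p.δΔ * ρ₁ ‖s.X τ‖ ^ 2 := by
    have := p.δΔ_pos.ne'
    field_simp
  rw [hdiv] at hobs
  rw [inner_neg_right] at happ hrem
  rw [data_eq, map_sub, map_sub, map_sub, inner_sub_right, inner_sub_right, inner_sub_right,
    p.inner_JT _ _ _ (p.J _ _ _)]
  linarith

theorem inner_sum_data_le (hb : p.IsBounding ρ₁ ρ₂ ρ₃ ρ₅) (hts : ∀ i, p.t₀ ≤ s.ts i)
    (hθ : s.θh t ∈ p.Θε) (hΔ : ∀ i ∈ s.stack t, ‖s.Δt p (s.ts i)‖ ≤ p.δΔ) :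
    inner ℝ (s.θt p t) (∑ i ∈ s.stack t, p.JT (s.X (s.ts i)) (s.θh t)
      (s.u p (s.ts i) - s.Δh (s.ts i) + p.J (s.X (s.ts i)) (s.θh t) (s.θh t))) ≤
    -inner ℝ (s.gram p t (s.θt p t)) (s.θt p t) +
      N * (p.δΔ / 2 + 1) * ‖s.θt p t‖ ^ 2 + N * p.δΔ / 2 * ∑ i, ρ₁ ‖s.X (s.ts i)‖ ^ 2 +
      1 / 2 * ∑ i, ρ₅ ‖s.X (s.ts i)‖ ^ 2 +
      1 / 2 * ((∑ i, ρ₃ ‖s.ζ p (s.ts i)‖ ^ 2 * ‖s.ζ p t‖ ^ 2) * ‖s.ζ p t‖ ^ 2) := by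
  have hδ := p.δΔ_pos
  have hcard : ((s.stack t).card : ℝ) ≤ N := by
    exact_mod_cast (Finset.card_le_univ _).trans_eq (Fintype.card_fin N)
  have hext : ∀ {g : Fin N → ℝ}, (∀ i, 0 ≤ g i) → ∑ i ∈ s.stack t, g i ≤ ∑ i, g i := fun hg =>
    Finset.sum_le_sum_of_subset_of_nonneg (Finset.subset_univ _) fun i _ _ => hg i
  have hjac : ∑ i ∈ s.stack t, ρ₁ ‖s.X (s.ts i)‖ ^ 2 ≤ N * ∑ i, ρ₁ ‖s.X (s.ts i)‖ ^ 2 := by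
    refine (hext fun i => sq_nonneg _).trans ?_
    rcases N.eq_zero_or_pos with rfl | hN
    · simp
    · exact le_mul_of_one_le_left (Finset.sum_nonneg fun i _ => sq_nonneg _) (mod_cast hN)
  have hpar : (s.stack t).card * ((p.δΔ / 2 + 1) * ‖s.θt p t‖ ^ 2) ≤
      N * ((p.δΔ / 2 + 1) * ‖s.θt p t‖ ^ 2) := by gcongr
  have hobs : p.δΔ / 2 * ∑ i ∈ s.stack t, ρ₁ ‖s.X (s.ts i)‖ ^ 2 ≤
      p.δΔ / 2 * (N * ∑ i, ρ₁ ‖s.X (s.ts i)‖ ^ 2) := by gcongr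
  have happ : ∑ i ∈ s.stack t, ρ₅ ‖s.X (s.ts i)‖ ^ 2 ≤ ∑ i, ρ₅ ‖s.X (s.ts i)‖ ^ 2 :=
    hext fun i => sq_nonneg _
  have hrem : (∑ i ∈ s.stack t, ρ₃ ‖s.ζ p (s.ts i)‖ ^ 2) * ‖s.ζ p t‖ ^ 2 * ‖s.ζ p t‖ ^ 2 ≤
      (∑ i, ρ₃ ‖s.ζ p (s.ts i)‖ ^ 2) * ‖s.ζ p t‖ ^ 2 * ‖s.ζ p t‖ ^ 2 := by
    gcongr
    exact Finset.subset_univ _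
  rw [inner_sum, inner_gram]
  refine (Finset.sum_le_sum fun i hi => inner_JT_data_le hb (hts i) hθ (hΔ i hi)).trans ?_
  simp only [Finset.sum_add_distrib, Finset.sum_neg_distrib, Finset.sum_const, nsmul_eq_mul,
    ← Finset.mul_sum, ← Finset.sum_mul]
  linarith

theorem tracking_le {εB : ℝ} (hb : p.IsBounding ρ₁ ρ₂ ρ₃ ρ₅) (ht : p.t₀ ≤ t)
    (hθ : s.θh t ∈ p.Θε) (hε : ‖p.appErr (s.X t)‖ ≤ εB) :
    inner ℝ (s.r p t) (s.acc p t - deriv (deriv p.xd) t + p.α₁ • s.edot p t) +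
      inner ℝ (s.e p t) (s.edot p t) ≤
    inner ℝ (p.J (s.X t) (s.θh t) (s.θt p t)) (s.r p t) - (p.k₁ - 1) * ‖s.r p t‖ ^ 2 -
      p.α₁ * ‖s.e p t‖ ^ 2 + 1 / 2 * ρ₂ ‖s.ζ p t‖ ^ 2 * ‖s.ζ p t‖ ^ 2 * ‖s.ζ p t‖ ^ 2 +
      1 / 2 * εB ^ 2 := by
  have happ := inner_le_half_sq_add_half_sq (x := s.r p t) hε
  have hrem := inner_le_half_sq_add_half_sq (x := s.r p t) (norm_rem_le hb ht hθ)
  rw [s.rdot_eq, ← s.r_sub_smul_e]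
  simp only [inner_sub_right, inner_add_right, real_inner_smul_right, real_inner_self_eq_norm_sq,
    real_inner_comm (s.e p t) (s.r p t),
    real_inner_comm (s.r p t) (p.J (s.X t) (s.θh t) (s.θt p t))]
  linarith

theorem inner_θt_θh_le :
    inner ℝ (s.θt p t) (s.θh t) ≤ -(1 / 2) * ‖s.θt p t‖ ^ 2 + 1 / 2 * p.θB ^ 2 := by
  have hθs := inner_le_half_sq_add_half_sq (x := s.θt p t) p.norm_θs_le
  rw [← s.θs_sub_θt p, inner_sub_right, real_inner_self_eq_norm_sq]
  linarith

end Signals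

namespace IsClosedLoop

variable {A : Arch} {N : ℕ} {p : Problem A} {s : Signals A N} {b : EReal} {δf t : ℝ}

theorem lyap_bounds (h : IsClosedLoop p s b δf) (ht : t ∈ span p.t₀ b) :
    p.β₁ * ‖s.ζ p t‖ ^ 2 ≤ s.lyap p t ∧ s.lyap p t ≤ p.β₂ * ‖s.ζ p t‖ ^ 2 := by
  have hΓ_lower := (h.Γinv_mem ht (s.θt p t)).1
  have hΓ_upper := (h.Γinv_mem ht (s.θt p t)).2
  rw [real_inner_comm] at hΓ_lower hΓ_upper
  rw [s.norm_sq_ζ, Signals.lyap, real_inner_self_eq_norm_sq, real_inner_self_eq_norm_sq,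
    mul_add, mul_add, mul_add, mul_add]
  have hlower : p.β₁ * ‖s.θt p t‖ ^ 2 ≤ 1 / 2 * (1 / p.lΓmax) * ‖s.θt p t‖ ^ 2 :=
    mul_le_mul_of_nonneg_right (min_le_right _ _) (sq_nonneg _)
  have hupper : 1 / 2 * (1 / p.lΓmin) * ‖s.θt p t‖ ^ 2 ≤ p.β₂ * ‖s.θt p t‖ ^ 2 :=
    mul_le_mul_of_nonneg_right (le_max_right _ _) (sq_nonneg _)
  refine ⟨add_le_add_three ?_ ?_ (by linarith), add_le_add_three ?_ ?_ (by linarith)⟩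
  · exact mul_le_mul_of_nonneg_right (min_le_left _ _) (sq_nonneg _)
  · exact mul_le_mul_of_nonneg_right (min_le_left _ _) (sq_nonneg _)
  · exact mul_le_mul_of_nonneg_right (le_max_left _ _) (sq_nonneg _)
  · exact mul_le_mul_of_nonneg_right (le_max_left _ _) (sq_nonneg _)

theorem hasACDeriv_lyap (h : IsClosedLoop p s b δf) (ht : t ∈ span p.t₀ b) :
    HasACDeriv (s.lyap p) (s.lyapDeriv p) p.t₀ t := by
  have hr := h.hasACDeriv_r ht
  have he := h.hasACDeriv_e ht
  have hθ : HasACDeriv (s.θt p) (fun τ => -s.θrhs p τ) p.t₀ t :=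
    (h.θ_law.hasACDeriv ht).const_sub p.θs
  have hΓ := (h.Γ_law.hasACDeriv ht).clm_apply hθ
  have hlyap := (((hr.inner hr).const_smul (1 / 2)).add ((he.inner he).const_smul (1 / 2))).add
    ((hθ.inner hΓ).const_smul (1 / 2))
  refine hlyap.congr_deriv fun τ hτ => ?_
  have hsymm : inner ℝ (s.θrhs p τ) (s.Γinv τ (s.θt p τ)) =
      inner ℝ (s.θt p τ) (s.Γinv τ (s.θrhs p τ)) := by
    rw [real_inner_comm]
    exact h.isSymmetric_Γinv (Icc_subset_span ht (uIcc_of_le ht.1 ▸ hτ)) _ _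
  simp only [Signals.lyapDeriv, smul_eq_mul, map_neg, inner_add_right, inner_neg_right,
    inner_neg_left, hsymm, real_inner_comm (s.Γrhs p τ (s.θt p τ)), real_inner_comm (s.r p τ),
    real_inner_comm (s.e p τ)]
  ring

theorem inner_Γrhs_le (h : IsClosedLoop p s b δf) (ht : t ∈ span p.t₀ b) (w : A.Par) :
    inner ℝ (s.Γrhs p t w) w ≤ p.γ₁ * inner ℝ (s.gram p t w) w := by
  unfold Signals.Γrhs
  split_ifs
  · have hΓ : 0 ≤ inner ℝ (s.Γinv t w) w :=
      (mul_nonneg (one_div_nonneg.2 p.lΓmax_pos.le) (sq_nonneg _)).trans (h.Γinv_mem ht w).1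
    simp only [add_apply, neg_apply, smul_apply, inner_add_left, inner_neg_left,
      real_inner_smul_left]
    linarith [mul_nonneg (p.β_nonneg t) hΓ]
  · have hgram : 0 ≤ inner ℝ (s.gram p t w) w := by
      rw [s.inner_gram]
      exact Finset.sum_nonneg fun i _ => real_inner_self_nonneg
    simpa using mul_nonneg p.γ₁_pos.le hgram

theorem inner_θt_Γinv_rawLaw_le (h : IsClosedLoop p s b δf) (ht : t ∈ span p.t₀ b) :
    inner ℝ (s.θt p t) (s.Γinv t (s.rawLaw p t)) ≤
      inner ℝ (s.θt p t) (s.Γinv t (s.θrhs p t)) := by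
  refine inner_inv_le_inner_inv_proj p.P_convex p.εP_pos
    (p.P_C1.differentiable one_ne_zero).differentiableAt (h.Γinv_Γ ht) ?_ p.θs_mem _
  rcases eq_or_ne (gradient p.P (s.θh t)) 0 with hgrad | hgrad
  · rw [hgrad, inner_zero_left]
  · exact (h.inner_Γ_pos ht hgrad).le

theorem adaptation_le (h : IsClosedLoop p s b δf) {ρ₁ ρ₂ ρ₃ ρ₅ : ℝ → ℝ} {lam_e : ℝ}
    (hb : p.IsBounding ρ₁ ρ₂ ρ₃ ρ₅) (ht : t ∈ span p.t₀ b) (hexc : lam_e ≤ lamMin (s.gram p t))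
    (hΔ : ∀ i ∈ s.stack t, ‖s.Δt p (s.ts i)‖ ≤ p.δΔ) :
    1 / 2 * inner ℝ (s.Γrhs p t (s.θt p t)) (s.θt p t) -
      inner ℝ (s.θt p t) (s.Γinv t (s.θrhs p t)) ≤
    -inner ℝ (p.J (s.X t) (s.θh t) (s.θt p t)) (s.r p t) -
      (p.γ₁ / 2 * lam_e + p.γ₂ / 2 - p.γ₁ * N * p.δΔ / 2 - p.γ₁ * N) * ‖s.θt p t‖ ^ 2 +
      p.γ₁ * N * p.δΔ / 2 * ∑ i, ρ₁ ‖s.X (s.ts i)‖ ^ 2 +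
      p.γ₁ / 2 * ∑ i, ρ₅ ‖s.X (s.ts i)‖ ^ 2 + p.γ₂ / 2 * p.θB ^ 2 +
      p.γ₁ / 2 * (∑ i, ρ₃ ‖s.ζ p (s.ts i)‖ ^ 2 * ‖s.ζ p t‖ ^ 2) * ‖s.ζ p t‖ ^ 2 := by
  have hproj := h.inner_θt_Γinv_rawLaw_le ht
  rw [Signals.rawLaw, h.Γinv_Γ ht, inner_sub_right, inner_sub_right, real_inner_smul_right,
    real_inner_smul_right, p.inner_JT] at hproj
  have hdata := mul_le_mul_of_nonneg_left (Signals.inner_sum_data_le hb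
    (fun i => (h.rec_mem i).1) (h.θh_mem ht) hΔ) p.γ₁_pos.le
  have hΓ := h.inner_Γrhs_le ht (s.θt p t)
  have hgram : lam_e * ‖s.θt p t‖ ^ 2 ≤ inner ℝ (s.gram p t (s.θt p t)) (s.θt p t) :=
    (mul_le_mul_of_nonneg_right hexc (sq_nonneg _)).trans
      (lamMin_mul_le_inner (s.isSymmetric_gram p t) _)
  have hexcited := mul_le_mul_of_nonneg_left hgram p.γ₁_pos.le
  have hdamping := mul_le_mul_of_nonneg_left
    (Signals.inner_θt_θh_le (s := s) (p := p) (t := t)) p.γ₂_pos.le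
  linarith

theorem lyapDeriv_le (h : IsClosedLoop p s b δf) {ρ₁ ρ₂ ρ₃ ρ₅ : ℝ → ℝ} {εB lam_e : ℝ}
    (hb : p.IsBounding ρ₁ ρ₂ ρ₃ ρ₅) (ht : t ∈ span p.t₀ b)
    (hε : ‖p.appErr (s.X t)‖ ≤ εB) (hexc : lam_e ≤ lamMin (s.gram p t))
    (hΔ : ∀ i ∈ s.stack t, ‖s.Δt p (s.ts i)‖ ≤ p.δΔ) :
    s.lyapDeriv p t ≤ (1 / 2 * ρ₂ ‖s.ζ p t‖ ^ 2 * ‖s.ζ p t‖ ^ 2 +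
      p.γ₁ / 2 * ∑ i, ρ₃ ‖s.ζ p (s.ts i)‖ ^ 2 * ‖s.ζ p t‖ ^ 2 - p.lam₃ N lam_e) * ‖s.ζ p t‖ ^ 2 +
      s.ι₄ p ρ₁ ρ₅ εB := by
  have htracking := Signals.tracking_le hb ht.1 (h.θh_mem ht) hε
  have hadaptation := h.adaptation_le hb ht hexc hΔ
  have hr : p.lam₃ N lam_e * ‖s.r p t‖ ^ 2 ≤ (p.k₁ - 1) * ‖s.r p t‖ ^ 2 :=
    mul_le_mul_of_nonneg_right (min_le_left _ _) (sq_nonneg _)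
  have he : p.lam₃ N lam_e * ‖s.e p t‖ ^ 2 ≤ p.α₁ * ‖s.e p t‖ ^ 2 :=
    mul_le_mul_of_nonneg_right ((min_le_right _ _).trans (min_le_left _ _)) (sq_nonneg _)
  have hθ : p.lam₃ N lam_e * ‖s.θt p t‖ ^ 2 ≤
      (p.γ₁ / 2 * lam_e + p.γ₂ / 2 - p.γ₁ * N * p.δΔ / 2 - p.γ₁ * N) * ‖s.θt p t‖ ^ 2 :=
    mul_le_mul_of_nonneg_right ((min_le_right _ _).trans (min_le_right _ _)) (sq_nonneg _)
  have hsplit : p.lam₃ N lam_e * ‖s.ζ p t‖ ^ 2 = p.lam₃ N lam_e * ‖s.r p t‖ ^ 2 +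
      p.lam₃ N lam_e * ‖s.e p t‖ ^ 2 + p.lam₃ N lam_e * ‖s.θt p t‖ ^ 2 := by
    rw [s.norm_sq_ζ]
    ring
  rw [sub_mul, hsplit]
  unfold Signals.lyapDeriv Signals.ι₄
  linarith

theorem lyapDeriv_le_neg_mul_lyap_add (h : IsClosedLoop p s b δf) {c d lam : ℝ}
    (hlam : 0 < lam) (ht : t ∈ span p.t₀ b) (hc : c ≤ -lam)
    (hderiv : s.lyapDeriv p t ≤ c * ‖s.ζ p t‖ ^ 2 + d) :
    s.lyapDeriv p t ≤ -(lam / p.β₂) * s.lyap p t + d := by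
  have hζ : c * ‖s.ζ p t‖ ^ 2 ≤ -lam * ‖s.ζ p t‖ ^ 2 :=
    mul_le_mul_of_nonneg_right hc (sq_nonneg _)
  have hlyap : lam / p.β₂ * s.lyap p t ≤ lam * ‖s.ζ p t‖ ^ 2 := by
    rw [div_mul_eq_mul_div, div_le_iff₀ p.β₂_pos, mul_assoc, mul_comm (_ ^ 2)]
    exact mul_le_mul_of_nonneg_left (h.lyap_bounds ht).2 hlam.le
  linarith

end IsClosedLoop

/-! ### Invariance of the ball -/

namespace Signals

variable {A : Arch} {N : ℕ} {s : Signals A N} {p : Problem A} {ρ₁ ρ₅ : ℝ → ℝ}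
  {εB lam₃d χ₄ T t : ℝ}

variable (s p ρ₁ ρ₅ εB lam₃d T t) in
/-- The square of the exponential envelope for `‖ζ‖` that starts at time `T`. -/
noncomputable def sqEnvelope : ℝ :=
  p.β₂ / p.β₁ * ‖s.ζ p T‖ ^ 2 * Real.exp (-(lam₃d / p.β₂) * (t - T)) +
    p.β₂ * s.ι₄ p ρ₁ ρ₅ εB / (p.β₁ * lam₃d) * (1 - Real.exp (-(lam₃d / p.β₂) * (t - T)))

theorem norm_sq_ζ_le_sqEnvelope_self : ‖s.ζ p T‖ ^ 2 ≤ s.sqEnvelope p ρ₁ ρ₅ εB lam₃d T T := by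
  simpa [sqEnvelope] using
    le_mul_of_one_le_left (sq_nonneg ‖s.ζ p T‖) ((one_le_div p.β₁_pos).2 p.β₁_le_β₂)

theorem sqEnvelope_lt (h3d : 0 < lam₃d) (hTt : T ≤ t)
    (hH : s.ζ p T ∈ s.H p ρ₁ ρ₅ εB χ₄ lam₃d) :
    s.sqEnvelope p ρ₁ ρ₅ εB lam₃d T t < χ₄ ^ 2 := by
  have hβ₁ := p.β₁_pos
  have hβ₂ := p.β₂_pos
  have hfinal : 0 ≤ p.β₂ * s.ι₄ p ρ₁ ρ₅ εB / (p.β₁ * lam₃d) :=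
    div_nonneg (mul_nonneg hβ₂.le (s.ι₄_nonneg p _ _ _)) (mul_pos hβ₁ h3d).le
  have hinit : 0 ≤ p.β₂ / p.β₁ * ‖s.ζ p T‖ ^ 2 := by positivity
  have hsum : p.β₂ / p.β₁ * ‖s.ζ p T‖ ^ 2 + p.β₂ * s.ι₄ p ρ₁ ρ₅ εB / (p.β₁ * lam₃d) < χ₄ ^ 2 := by
    have hscaled := mul_lt_mul_of_pos_left ((Real.lt_sqrt (norm_nonneg _)).1 hH)
      (div_pos hβ₂ hβ₁)
    have hradicand : p.β₂ / p.β₁ * (p.β₁ / p.β₂ * χ₄ ^ 2 - s.ι₄ p ρ₁ ρ₅ εB / lam₃d) =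
        χ₄ ^ 2 - p.β₂ * s.ι₄ p ρ₁ ρ₅ εB / (p.β₁ * lam₃d) := by field_simp
    linarith
  have hexp : Real.exp (-(lam₃d / p.β₂) * (t - T)) ≤ 1 :=
    exp_neg_mul_le_one (div_pos h3d hβ₂).le (sub_nonneg.2 hTt)
  refine (add_le_add ?_ ?_).trans_lt hsum
  · exact mul_le_of_le_one_right hinit hexp
  · exact mul_le_of_le_one_right hfinal (sub_le_self _ (Real.exp_pos _).le)

end Signals

namespace IsClosedLoop

variable {A : Arch} {N : ℕ} {p : Problem A} {s : Signals A N} {b : EReal}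
  {ρ₁ ρ₂ ρ₃ ρ₅ : ℝ → ℝ} {δf εB lam_e lam₃d χ₄ T t : ℝ}

theorem norm_sq_ζ_le_sqEnvelope (h : IsClosedLoop p s b δf) (h3d : 0 < lam₃d)
    (hT : p.t₀ ≤ T) (hTt : T ≤ t) (ht : t ∈ span p.t₀ b)
    (hV : ∀ τ ∈ Ioo T t, s.lyapDeriv p τ ≤ -(lam₃d / p.β₂) * s.lyap p τ + s.ι₄ p ρ₁ ρ₅ εB) :
    ‖s.ζ p t‖ ^ 2 ≤ s.sqEnvelope p ρ₁ ρ₅ εB lam₃d T t := by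
  have hβ₁ := p.β₁_pos
  have hβ₂ := p.β₂_pos
  have hac : HasACDeriv (s.lyap p) (s.lyapDeriv p) T t :=
    (h.hasACDeriv_lyap ht).mono (by
      rw [uIcc_of_le hTt, uIcc_of_le ht.1]
      exact Icc_subset_Icc_left hT)
  set E := Real.exp (-(lam₃d / p.β₂) * (t - T)) with hE
  have hdecay : p.β₁ * ‖s.ζ p t‖ ^ 2 ≤
      p.β₂ * ‖s.ζ p T‖ ^ 2 * E + s.ι₄ p ρ₁ ρ₅ εB / (lam₃d / p.β₂) * (1 - E) :=
    calc p.β₁ * ‖s.ζ p t‖ ^ 2 ≤ s.lyap p t := (h.lyap_bounds ht).1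
      _ ≤ s.lyap p T * E + s.ι₄ p ρ₁ ρ₅ εB / (lam₃d / p.β₂) * (1 - E) :=
        hac.le_exp_of_le hTt (div_pos h3d hβ₂) hV
      _ ≤ _ := by
        gcongr
        exact (h.lyap_bounds (span_of_le ht hT hTt)).2
  rw [← le_div_iff₀' hβ₁] at hdecay
  refine hdecay.trans_eq ?_
  rw [Signals.sqEnvelope, ← hE]
  field_simp

theorem lyapDeriv_le_of_mem_D (h : IsClosedLoop p s b δf) (hb : p.IsBounding ρ₁ ρ₂ ρ₃ ρ₅)
    (hχ : 1 / 2 * ρ₂ χ₄ ^ 2 * χ₄ ^ 2 + p.γ₁ / 2 * ∑ i, ρ₃ ‖s.ζ p (s.ts i)‖ ^ 2 * χ₄ ^ 2 ≤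
      p.lam₃ N lam_e - lam₃d)
    (hε : ∀ X ∈ p.Ω χ₄, ‖p.appErr X‖ ≤ εB) (hf : p.IsFdotBound χ₄ δf)
    (hgain : δf ^ 2 / p.δΔ ^ 2 < p.kΔ * p.Λ₁) (h3d : 0 < lam₃d) (ht : t ∈ span p.t₀ b)
    (hexc : lam_e ≤ lamMin (s.gram p t)) (hD : ∀ τ ∈ Icc p.t₀ t, s.ζ p τ ∈ p.D χ₄) :
    s.lyapDeriv p t ≤ -(lam₃d / p.β₂) * s.lyap p t + s.ι₄ p ρ₁ ρ₅ εB := by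
  have hζ : ‖s.ζ p t‖ ≤ χ₄ := hD t ⟨ht.1, le_rfl⟩
  have hρ₂ : ρ₂ ‖s.ζ p t‖ ≤ ρ₂ χ₄ := hb.incr₂.le (norm_nonneg _) hζ
  have hρ₂_nonneg : 0 ≤ ρ₂ ‖s.ζ p t‖ := hb.incr₂.2 _ (norm_nonneg _)
  have hγ₁ := p.γ₁_pos
  have hsmall : 1 / 2 * ρ₂ ‖s.ζ p t‖ ^ 2 * ‖s.ζ p t‖ ^ 2 +
      p.γ₁ / 2 * ∑ i, ρ₃ ‖s.ζ p (s.ts i)‖ ^ 2 * ‖s.ζ p t‖ ^ 2 ≤ p.lam₃ N lam_e - lam₃d :=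
    hχ.trans' (by gcongr)
  refine h.lyapDeriv_le_neg_mul_lyap_add h3d ht (by linarith)
    (h.lyapDeriv_le hb ht (hε _ (s.X_mem_Ω p ht.1 hζ)) hexc fun i hi => ?_)
  have hrecorded : s.ts i ≤ t := (Finset.mem_filter.1 hi).2
  exact h.norm_Δt_le hf hgain (h.rec_mem i)
    (fun τ hτ => hD τ ⟨hτ.1, hτ.2.trans hrecorded⟩) (h.rec_late i)

theorem ζ_mem_D (h : IsClosedLoop p s b δf) (hχ₄ : 0 ≤ χ₄) (h3d : 0 < lam₃d) (hT : p.t₀ ≤ T)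
    (hV : ∀ τ ∈ span p.t₀ b, T ≤ τ → (∀ σ ∈ Icc p.t₀ τ, s.ζ p σ ∈ p.D χ₄) →
      s.lyapDeriv p τ ≤ -(lam₃d / p.β₂) * s.lyap p τ + s.ι₄ p ρ₁ ρ₅ εB)
    (hpre : ∀ τ, p.t₀ ≤ τ → τ < T → s.ζ p τ ∈ p.D χ₄)
    (hH : s.ζ p T ∈ s.H p ρ₁ ρ₅ εB χ₄ lam₃d) (ht : t ∈ span p.t₀ b) : s.ζ p t ∈ p.D χ₄ := by
  rcases lt_or_ge t T with htT | hTt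
  · exact hpre t ht.1 htT
  have hcont : ContinuousOn (fun τ => ‖s.ζ p τ‖) (Icc T t) :=
    h.continuousOn_ζ.norm.mono ((Icc_subset_Icc_left hT).trans (Icc_subset_span ht))
  have hζT : ‖s.ζ p T‖ ≤ χ₄ := le_of_sq_le_sq
    (Signals.norm_sq_ζ_le_sqEnvelope_self.trans (Signals.sqEnvelope_lt h3d le_rfl hH).le) hχ₄
  refine (forall_lt_of_forall_le_imp_lt hcont hζT (fun c hc hball => ?_) t ⟨hTt, le_rfl⟩).le
  have hD : ∀ τ ∈ Icc p.t₀ c, s.ζ p τ ∈ p.D χ₄ := fun τ hτ =>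
    (lt_or_ge τ T).elim (hpre τ hτ.1) fun hTτ => hball τ ⟨hTτ, hτ.2⟩
  have hc_mem := span_of_le ht (hT.trans hc.1) hc.2
  have hζc := h.norm_sq_ζ_le_sqEnvelope h3d hT hc.1 hc_mem fun τ hτ =>
    hV τ (span_of_le hc_mem (hT.trans hτ.1.le) hτ.2.le) hτ.1.le
      fun σ hσ => hD σ ⟨hσ.1, hσ.2.trans hτ.2.le⟩
  exact lt_of_pow_lt_pow_left₀ 2 hχ₄ (hζc.trans_lt (Signals.sqEnvelope_lt h3d hc.1 hH))

end IsClosedLoop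

/-! ### Boundedness of the signals -/

theorem isBigO_one_of_forall_norm_le {α E : Type*} [Norm E] {S : Set α} {y : α → E} {C : ℝ}
    (hy : ∀ t ∈ S, ‖y t‖ ≤ C) : y =O[𝓟 S] fun _ => (1 : ℝ) :=
  isBigO_principal.2 ⟨C, by simpa only [norm_one, mul_one] using hy⟩

theorem isBigO_one_comp_of_isCompact {α W E : Type*} [TopologicalSpace W] [NormedAddCommGroup E]
    {S : Set α} {K : Set W} {F : W → E} {y : α → W} (hK : IsCompact K) (hF : Continuous F)
    (hy : ∀ t ∈ S, y t ∈ K) : (fun t => F (y t)) =O[𝓟 S] fun _ => (1 : ℝ) :=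
  have ⟨_, hC⟩ := hK.exists_bound_of_continuousOn hF.continuousOn
  isBigO_one_of_forall_norm_le fun t ht => hC _ (hy t ht)

theorem Problem.isCompact_Ω {A : Arch} (p : Problem A) (χ : ℝ) : IsCompact (p.Ω χ) := by
  simpa only [Problem.Ω, Metric.closedBall, dist_zero_right] using
    isCompact_closedBall (0 : A.Inp) ((p.α₁ + 2) * χ + p.xdB + p.xdB')

namespace Signals

variable {A : Arch} {N : ℕ} {s : Signals A N} {p : Problem A} {b : EReal} {χ : ℝ}

theorem isBigO_r (hD : ∀ t ∈ span p.t₀ b, s.ζ p t ∈ p.D χ) :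
    s.r p =O[𝓟 (span p.t₀ b)] fun _ => (1 : ℝ) :=
  isBigO_one_of_forall_norm_le fun t ht => (Arch.norm_fst_le_norm_err _ _ _).trans (hD t ht)

theorem isBigO_e (hD : ∀ t ∈ span p.t₀ b, s.ζ p t ∈ p.D χ) :
    s.e p =O[𝓟 (span p.t₀ b)] fun _ => (1 : ℝ) :=
  isBigO_one_of_forall_norm_le fun t ht => (Arch.norm_snd_le_norm_err _ _ _).trans (hD t ht)

theorem isBigO_u (hD : ∀ t ∈ span p.t₀ b, s.ζ p t ∈ p.D χ)
    (hθ : ∀ t ∈ span p.t₀ b, s.θh t ∈ p.Θε) : s.u p =O[𝓟 (span p.t₀ b)] fun _ => (1 : ℝ) := by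
  have hr := isBigO_r hD
  have he := isBigO_e hD
  have hed : s.edot p =O[𝓟 (span p.t₀ b)] fun _ => (1 : ℝ) :=
    (hr.sub (he.const_smul_left p.α₁)).congr_left (s.r_sub_smul_e p)
  have hxd'' : deriv (deriv p.xd) =O[𝓟 (span p.t₀ b)] fun _ => (1 : ℝ) :=
    isBigO_one_of_forall_norm_le fun t ht => p.xd''_le t ht.1
  have hΦ : (fun t => p.Φ (s.X t) (s.θh t)) =O[𝓟 (span p.t₀ b)] fun _ => (1 : ℝ) :=
    isBigO_one_comp_of_isCompact ((p.isCompact_Ω χ).prod p.isCompact_Θε) p.continuous_Φ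
      (y := fun t => (s.X t, s.θh t)) fun t ht => ⟨s.X_mem_Ω p ht.1 (hD t ht), hθ t ht⟩
  exact (((hxd''.sub hΦ).sub (hr.const_smul_left p.k₁)).sub he).sub (hed.const_smul_left p.α₁)

end Signals

namespace IsClosedLoop

variable {A : Arch} {N : ℕ} {p : Problem A} {s : Signals A N} {b : EReal} {δf χ : ℝ}

theorem exists_forall_norm_le (h : IsClosedLoop p s b δf) (hf : p.IsFdotBound χ δf)
    (hD : ∀ t ∈ span p.t₀ b, s.ζ p t ∈ p.D χ) :
    ∃ C : ℝ, ∀ t ∈ span p.t₀ b,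
      ‖s.e p t‖ ≤ C ∧ ‖s.r p t‖ ≤ C ∧ ‖s.θt p t‖ ≤ C ∧ ‖s.x t‖ ≤ C ∧ ‖s.v t‖ ≤ C ∧
      ‖s.θh t‖ ≤ C ∧ ‖s.u p t‖ ≤ C ∧ ‖s.z p t‖ ≤ C ∧ ‖s.rh t‖ ≤ C ∧ ‖s.Δh t‖ ≤ C ∧
      ‖s.Γ t‖ ≤ C ∧ ‖s.Γinv t‖ ≤ C := by
  have hX : ∀ t ∈ span p.t₀ b, s.X t ∈ p.Ω χ := fun t ht => s.X_mem_Ω p ht.1 (hD t ht)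
  have he := Signals.isBigO_e hD
  have hr := Signals.isBigO_r hD
  have hθt : s.θt p =O[𝓟 (span p.t₀ b)] fun _ => (1 : ℝ) := isBigO_one_of_forall_norm_le
    fun t ht => (Arch.norm_thd_le_norm_err _ _ _).trans (hD t ht)
  have hx : s.x =O[𝓟 (span p.t₀ b)] fun _ => (1 : ℝ) := isBigO_one_of_forall_norm_le
    fun t ht => (Arch.norm_fst_le_norm_pair _ _).trans (hX t ht)
  have hv : s.v =O[𝓟 (span p.t₀ b)] fun _ => (1 : ℝ) := isBigO_one_of_forall_norm_le
    fun t ht => (Arch.norm_snd_le_norm_pair _ _).trans (hX t ht)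
  have hθh : s.θh =O[𝓟 (span p.t₀ b)] fun _ => (1 : ℝ) :=
    isBigO_one_comp_of_isCompact (F := id) p.isCompact_Θε continuous_id fun t ht => h.θh_mem ht
  have hu := Signals.isBigO_u hD fun t ht => h.θh_mem ht
  have hz : s.z p =O[𝓟 (span p.t₀ b)] fun _ => (1 : ℝ) := isBigO_one_of_forall_norm_le
    fun t ht => Real.le_sqrt_of_sq_le
      (h.norm_sq_z_le_const hf ht fun τ hτ => hD τ (Icc_subset_span ht hτ))
  have hrh : s.rh =O[𝓟 (span p.t₀ b)] fun _ => (1 : ℝ) :=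
    (hr.sub ((isBigO_of_le _ (s.norm_rt_le_norm_z p)).trans hz)).congr_left
      fun t => sub_sub_cancel _ _
  have hΔh : s.Δh =O[𝓟 (span p.t₀ b)] fun _ => (1 : ℝ) :=
    (((isBigO_one_comp_of_isCompact (p.isCompact_Ω χ) p.f_C1.continuous hX).add hu).sub
      ((isBigO_of_le _ (s.norm_Δt_le_norm_z p)).trans hz)).congr_left fun t => sub_sub_cancel _ _
  have hΓ : s.Γ =O[𝓟 (span p.t₀ b)] fun _ => (1 : ℝ) :=
    isBigO_one_of_forall_norm_le fun t ht => h.norm_Γ_le ht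
  have hΓinv : s.Γinv =O[𝓟 (span p.t₀ b)] fun _ => (1 : ℝ) :=
    isBigO_one_of_forall_norm_le fun t ht => h.norm_Γinv_le ht
  obtain ⟨C, hC⟩ := isBigO_principal.1 (he.prod_left (hr.prod_left (hθt.prod_left (hx.prod_left
    (hv.prod_left (hθh.prod_left (hu.prod_left (hz.prod_left (hrh.prod_left (hΔh.prod_left
      (hΓ.prod_left hΓinv)))))))))))
  exact ⟨C, fun t ht => by simpa only [Prod.norm_mk, max_le_iff, norm_one, mul_one] using hC t ht⟩

end IsClosedLoop

end CLDNN

theorem mainTheorem2_general {A : CLDNN.Arch} {p : CLDNN.Problem A} {N : ℕ}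
    {s : CLDNN.Signals A N} {b : EReal} {ρ₁ ρ₂ ρ₃ ρ₅ : ℝ → ℝ} {δf εB lam_e T lam₃d χ₄ : ℝ}
    (hb : p.IsBounding ρ₁ ρ₂ ρ₃ ρ₅) (hχ₄ : 0 ≤ χ₄)
    (hχ : 1 / 2 * ρ₂ χ₄ ^ 2 * χ₄ ^ 2 + p.γ₁ / 2 * ∑ i, ρ₃ ‖s.ζ p (s.ts i)‖ ^ 2 * χ₄ ^ 2 ≤
      p.lam₃ N lam_e - lam₃d)
    (hε : ∀ X ∈ p.Ω χ₄, ‖p.appErr X‖ ≤ εB) (hf : p.IsFdotBound χ₄ δf)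
    (hgain : δf ^ 2 / p.δΔ ^ 2 < p.kΔ * p.Λ₁) (h3d : 0 < lam₃d)
    (h : CLDNN.IsClosedLoop p s b δf) (hT : T ∈ CLDNN.span p.t₀ b)
    (hexc : ∀ t ∈ CLDNN.span p.t₀ b, T ≤ t → lam_e ≤ CLDNN.lamMin (s.gram p t))
    (hpre : ∀ t, p.t₀ ≤ t → t < T → s.ζ p t ∈ p.D χ₄)
    (hH : s.ζ p T ∈ s.H p ρ₁ ρ₅ εB χ₄ lam₃d) :
    (∀ t ∈ CLDNN.span p.t₀ b, T ≤ t → ‖s.ζ p t‖ ≤ √(s.sqEnvelope p ρ₁ ρ₅ εB lam₃d T t)) ∧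
    (∀ t ∈ CLDNN.span p.t₀ b, s.ζ p t ∈ p.D χ₄ ∧ s.X t ∈ p.Ω χ₄ ∧ s.θh t ∈ p.Θε) ∧
    ∃ C : ℝ, ∀ t ∈ CLDNN.span p.t₀ b,
      ‖s.e p t‖ ≤ C ∧ ‖s.r p t‖ ≤ C ∧ ‖s.θt p t‖ ≤ C ∧ ‖s.x t‖ ≤ C ∧ ‖s.v t‖ ≤ C ∧
      ‖s.θh t‖ ≤ C ∧ ‖s.u p t‖ ≤ C ∧ ‖s.z p t‖ ≤ C ∧ ‖s.rh t‖ ≤ C ∧ ‖s.Δh t‖ ≤ C ∧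
      ‖s.Γ t‖ ≤ C ∧ ‖s.Γinv t‖ ≤ C := by
  have hV : ∀ t ∈ CLDNN.span p.t₀ b, T ≤ t → (∀ τ ∈ Set.Icc p.t₀ t, s.ζ p τ ∈ p.D χ₄) →
      s.lyapDeriv p t ≤ -(lam₃d / p.β₂) * s.lyap p t + s.ι₄ p ρ₁ ρ₅ εB := fun t ht hTt =>
    h.lyapDeriv_le_of_mem_D hb hχ hε hf hgain h3d ht (hexc t ht hTt)
  have hD : ∀ t ∈ CLDNN.span p.t₀ b, s.ζ p t ∈ p.D χ₄ := fun t ht =>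
    h.ζ_mem_D hχ₄ h3d hT.1 hV hpre hH ht
  refine ⟨fun t ht hTt => Real.le_sqrt_of_sq_le ?_,
    fun t ht => ⟨hD t ht, s.X_mem_Ω p ht.1 (hD t ht), h.θh_mem ht⟩, h.exists_forall_norm_le hf hD⟩
  refine h.norm_sq_ζ_le_sqEnvelope h3d hT.1 hTt ht fun τ hτ => ?_
  have hτ_mem := CLDNN.span_of_le ht (hT.1.trans hτ.1.le) hτ.2.le
  exact hV τ hτ_mem hτ.1.le fun σ hσ => hD σ (CLDNN.Icc_subset_span hτ_mem hσ)

/-- The bounding functions and the bound on `d/dt f` exist, and for every choice of them every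
solution of the closed loop with the second concurrent-learning law satisfies the exponential
envelope from the time `T` on from which the history stack has excitation level `lam_e`
(`T = t₀` and `lam_e = 0` are allowed), and all its signals are bounded. -/
theorem mainTheorem2 {A : CLDNN.Arch} (p : CLDNN.Problem A) :
    (∃ ρ₁ ρ₂ ρ₃ ρ₅ : ℝ → ℝ, p.IsBounding ρ₁ ρ₂ ρ₃ ρ₅) ∧
    (∀ χ : ℝ, ∃ δf : ℝ, 0 < δf ∧ p.IsFdotBound χ δf) ∧
    ∀ (N : ℕ) (s : CLDNN.Signals A N) (b : EReal)
      (ρ₁ ρ₂ ρ₃ ρ₅ ρδ : ℝ → ℝ) (σ δf εB lam_e T lam₃d χ₄ : ℝ),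
      -- bounding functions, and the radius `χ₄ = ρδ⁻¹(λ₃ - λ₃d)`
      p.IsBounding ρ₁ ρ₂ ρ₃ ρ₅ →
      CLDNN.Problem.IncrNonneg ρδ →
      (∀ a : ℝ, 0 ≤ a → 1 / 2 * ρ₂ a ^ 2 * a ^ 2
        + p.γ₁ / 2 * ∑ i, ρ₃ ‖s.ζ p (s.ts i)‖ ^ 2 * a ^ 2 ≤ ρδ a) →
      0 ≤ χ₄ → ρδ χ₄ = p.lam₃ N lam_e - lam₃d →
      -- ideal weights and approximation error on `Ω`
      0 < σ → IsMinOn (p.loss σ (p.Ω χ₄)) p.Θ p.θs →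
      (∀ X ∈ p.Ω χ₄, ‖p.appErr X‖ ≤ εB) →
      -- gain conditions
      0 < δf → p.IsFdotBound χ₄ δf →
      δf ^ 2 / p.δΔ ^ 2 < p.kΔ * p.Λ₁ →
      0 < lam₃d →
      -- closed loop, excitation from time `T` on, initial condition
      CLDNN.IsClosedLoop p s b δf →
      0 ≤ lam_e → T ∈ CLDNN.span p.t₀ b →
      (∀ t ∈ CLDNN.span p.t₀ b, T ≤ t → lam_e ≤ CLDNN.lamMin (s.gram p t)) →
      (∀ t, p.t₀ ≤ t → t < T → s.ζ p t ∈ p.D χ₄) →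
      s.ζ p T ∈ s.H p ρ₁ ρ₅ εB χ₄ lam₃d →
      -- exponential envelope
      (∀ t ∈ CLDNN.span p.t₀ b, T ≤ t →
        ‖s.ζ p t‖ ≤ √(p.β₂ / p.β₁ * ‖s.ζ p T‖ ^ 2 * Real.exp (-(lam₃d / p.β₂) * (t - T))
          + p.β₂ * s.ι₄ p ρ₁ ρ₅ εB / (p.β₁ * lam₃d)
            * (1 - Real.exp (-(lam₃d / p.β₂) * (t - T))))) ∧
      -- invariance
      (∀ t ∈ CLDNN.span p.t₀ b,
        s.ζ p t ∈ p.D χ₄ ∧ s.X t ∈ p.Ω χ₄ ∧ s.θh t ∈ p.Θε) ∧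
      -- boundedness of all signals
      ∃ C : ℝ, ∀ t ∈ CLDNN.span p.t₀ b,
        ‖s.e p t‖ ≤ C ∧ ‖s.r p t‖ ≤ C ∧ ‖s.θt p t‖ ≤ C ∧ ‖s.x t‖ ≤ C ∧ ‖s.v t‖ ≤ C ∧
        ‖s.θh t‖ ≤ C ∧ ‖s.u p t‖ ≤ C ∧ ‖s.z p t‖ ≤ C ∧ ‖s.rh t‖ ≤ C ∧ ‖s.Δh t‖ ≤ C ∧
        ‖s.Γ t‖ ≤ C ∧ ‖s.Γinv t‖ ≤ C := by
  refine ⟨p.exists_isBounding, p.exists_isFdotBound, ?_⟩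
  intro N s b ρ₁ ρ₂ ρ₃ ρ₅ ρδ σ δf εB lam_e T lam₃d χ₄ hb _ hδ hχ₄ hχ _ _ hε _ hf hgain h3d h _
  exact mainTheorem2_general hb hχ₄ ((hδ χ₄ hχ₄).trans_eq hχ) hε hf hgain h3d h
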